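/- Polytopes are abstract polytopes: an $n$-polytope is a ranked partially ordered set of faces with ranks $-1,0,\dots,n$, a least and a greatest face, all of whose flags (maximal chains) have $n+2$ faces, which is strongly flag-connected and satisfies the diamond condition. Two flags are ($i$-)adjacent if they differ in exactly one face (their $i$-face). The group $\Gamma(\mathcal R)$ of automorphisms of a polytope $\mathcal R$ acts on the left. The polytope is regular if $\Gamma(\mathcal R)$ is transitive on flags, and chiral if $\Gamma(\mathcal R)$ has exactly two flag orbits and adjacent flags always lie in distinct orbits. Fix a base flag $\{F_{-1},F_0,\dots,F_n\}$. If $\mathcal R$ is regular, let $\rho_i$ ($0\le i\le n-1$) be the automorphism mapping the base flag to its $i$-adjacent flag, and put $\sigma_i=\rho_{i-1}\rho_i$ ($1\le i\le n-1$). If $\mathcal R$ is chiral, let $\sigma_i$ be the automorphism which fixes all $F_k$ with $k\ne i-1,i$ and maps $F_i'$ to $F_i$, where $F_i'\neq F_i$ is the other $i$-face between $F_{i-1}$ and $F_{i+1}$. Put $\Gamma^+(\mathcal R)=\langle\sigma_1,\dots,\sigma_{n-1}\rangle$; this is all of $\Gamma(\mathcal R)$ if $\mathcal R$ is chiral. A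 regular polytope is directly regular if $\Gamma^+(\mathcal R)$ has index $2$ in $\Gamma(\mathcal R)$. A regular or chiral polytope has type $\{p_1,\dots,p_{n-1}\}$ if $\sigma_j$ has order $p_j$ for each $j$. Let $W=\langle r_0,\dots,r_{n-1}\mid r_i^2=1,\ (r_ir_j)^2=1 \text{ for } |i-j|\ge 2\rangle$, let $s_i=r_{i-1}r_i$ and $W^+=\langle s_1,\dots,s_{n-1}\rangle$. A chiral $n$-polytope $\mathcal P$ is totally chiral if the smallest normal subgroup of $W$ containing the kernel of the epimorphism $W^+\to\Gamma(\mathcal P)$, $s_i\mapsto\sigma_i$, is $W^+$. Let $\mathcal P$ and $\mathcal Q$ be $n$-polytopes, each chiral or directly regular, with base flags and corresponding generators $\sigma_i$ and $\sigma_i'$ of $\Gamma^+(\mathcal P)$ and $\Gamma^+(\mathcal Q)$. Put $\tau_i=(\sigma_i,\sigma_i')$ and $\Gamma=\langle\tau_1,\dots,\tau_{n-1}\rangle\le\Gamma^+(\mathcal P)\times\Gamma^+(\mathcal Q)$. The mix $\mathcal P\diamondsuit\mathcal Q$ is the ranked structure whose $j$-faces ($-1\le j\le n$) are the left cosets in $\Gamma$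 of the subgroup $\Gamma_j$ generated by all $\tau_i$ with $i\neq j,j+1$ and, if $1\le j\le n-2$, by $\tau_j\tau_{j+1}$, where $\varphi\Gamma_i\le\psi\Gamma_j$ if and only if $i\le j$ and $\varphi\Gamma_i\cap\psi\Gamma_j\ne\emptyset$. **Theorem.** Let $\mathcal P$ be a finite chiral $n$-polytope of type $\{p_1,\dots,p_{n-1}\}$ and $\mathcal Q$ a finite directly regular $n$-polytope of type $\{q_1,\dots,q_{n-1}\}$, with $\gcd(p_j,q_j)=1$ for every $j$. Then, for any choice of base flags: 1. $\Gamma=\Gamma(\mathcal P)\times\Gamma^+(\mathcal Q)$, and $\mathcal P\diamondsuit\mathcal Q$ is an $n$-polytope of type $\{p_1q_1,\dots,p_{n-1}q_{n-1}\}$. It is either chiral, with automorphism group isomorphic to $\Gamma(\mathcal P)\times\Gamma^+(\mathcal Q)$, or directly regular, with rotation group $\Gamma^+(\mathcal P\diamondsuit\mathcal Q)$ isomorphic to $\Gamma(\mathcal P)\times\Gamma^+(\mathcal Q)$. 2. If moreover $\mathcal P$ is totally chiral and $\Gamma(\mathcal P)\times\Gamma^+(\mathcal Q)$ has no subgroup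 with a quotient isomorphic to $\Gamma(\mathcal P)\times\Gamma(\mathcal P)$, then $\mathcal P\diamondsuit\mathcal Q$ is chiral. The condition on subgroups holds in particular if $|\Gamma(\mathcal P)|$ does not divide $|\Gamma^+(\mathcal Q)|$. -/

import Mathlib

namespace AbsPoly

noncomputable section

/-! ### Abstract polytopes -/

/-- Two flags are `i`-adjacent if they differ in exactly their faces of rank `i`. -/
def IsAdj {P : Type*} [LE P] (rk : P → ℤ) (i : ℤ) (Φ Ψ : Flag P) : Prop :=
  Φ ≠ Ψ ∧ ∀ F : P, rk F ≠ i → (F ∈ Φ ↔ F ∈ Ψ)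

/-- Two flags are adjacent if they differ in a single face. -/
def Adjacent {P : Type*} [LE P] (rk : P → ℤ) (Φ Ψ : Flag P) : Prop :=
  ∃ i : ℤ, IsAdj rk i Φ Ψ

/-- `P` with the rank function `rk` is an abstract polytope of rank `n`. That `≤` is a partial
order is part of the definition, so that it can be asserted of a set carrying only a relation. -/
structure IsPolytope (n : ℕ) {P : Type*} [LE P] (rk : P → ℤ) : Prop where
  refl : ∀ F : P, F ≤ F
  trans : ∀ F G H : P, F ≤ G → G ≤ H → F ≤ H
  antisymm : ∀ F G : P, F ≤ G → G ≤ F → F = G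
  rank_strictMono : ∀ F G : P, F ≤ G → F ≠ G → rk F < rk G
  rank_range : Set.range rk = Set.Icc (-1) (n : ℤ)
  exists_least : ∃ F₀ : P, ∀ F : P, F₀ ≤ F
  exists_greatest : ∃ F₁ : P, ∀ F : P, F ≤ F₁
  flag_ncard : ∀ Φ : Flag P, (Φ : Set P).ncard = n + 2
  strongly_flag_connected : ∀ Φ Ψ : Flag P,
    Relation.ReflTransGen
      (fun X Y : Flag P => Adjacent rk X Y ∧ ∀ F : P, F ∈ Φ → F ∈ Ψ → F ∈ Y) Φ Ψ
  diamond : ∀ (j : ℤ) (F G : P), F ≤ G → rk F = j - 1 → rk G = j + 1 →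
    {H : P | rk H = j ∧ F ≤ H ∧ H ≤ G}.ncard = 2

/-! ### Automorphisms, regularity, chirality -/

/-- Two flags lie in the same orbit under the automorphism group `P ≃o P`. -/
def SameOrbit {P : Type*} [LE P] (Φ Ψ : Flag P) : Prop :=
  ∃ g : P ≃o P, g '' (Φ : Set P) = (Ψ : Set P)

/-- The automorphism group is transitive on the flags. -/
def IsRegular (P : Type*) [LE P] : Prop :=
  ∀ Φ Ψ : Flag P, SameOrbit Φ Ψ

/-- The automorphism group has exactly two flag orbits, and adjacent flags are always in distinct
orbits. -/
def IsChiral {P : Type*} [LE P] (rk : P → ℤ) : Prop :=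
  (∃ Φ Ψ : Flag P, ¬ SameOrbit Φ Ψ ∧ ∀ X : Flag P, SameOrbit Φ X ∨ SameOrbit Ψ X) ∧
    ∀ Φ Ψ : Flag P, Adjacent rk Φ Ψ → ¬ SameOrbit Φ Ψ

/-- `g` maps the base flag `Φ` to the flag `i`-adjacent to `Φ`. -/
def IsReflection {P : Type*} [LE P] (rk : P → ℤ) (Φ : Flag P) (i : ℤ) (g : P ≃o P) : Prop :=
  ∃ Ψ : Flag P, IsAdj rk i Φ Ψ ∧ g '' (Φ : Set P) = (Ψ : Set P)

/-- `g` fixes the faces of the base flag `Φ = {F₋₁, F₀, …, Fₙ}` other than `Fᵢ₋₁` and `Fᵢ`, and it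
maps `Fᵢ'` to `Fᵢ`, where `Fᵢ' ≠ Fᵢ` is the other `i`-face between `Fᵢ₋₁` and `Fᵢ₊₁`. -/
def IsChiralRotation {P : Type*} [LE P] (rk : P → ℤ) (Φ : Flag P) (i : ℤ) (g : P ≃o P) : Prop :=
  (∀ F ∈ Φ, rk F ≠ i - 1 → rk F ≠ i → g F = F) ∧
    ∀ E ∈ Φ, ∀ F ∈ Φ, ∀ G ∈ Φ, rk E = i - 1 → rk F = i → rk G = i + 1 →
      ∀ F' : P, rk F' = i → F' ≠ F → E ≤ F' → F' ≤ G → g F' = F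

/-- The generator `ρᵢ` of the group of a regular polytope with respect to the base flag `Φ`
(such an automorphism exists and is unique for `0 ≤ i ≤ n - 1`). -/
def reflGen {P : Type*} [LE P] (rk : P → ℤ) (Φ : Flag P) (i : ℤ) : P ≃o P :=
  Classical.epsilon (IsReflection rk Φ i)

open Classical in
/-- The distinguished generator `σᵢ` (`1 ≤ i ≤ n - 1`) with respect to the base flag `Φ`: it is
`ρᵢ₋₁ρᵢ` for a regular polytope, and the (unique) automorphism as in `IsChiralRotation` for a
chiral polytope. Automorphisms act on the left. -/
def rotGen {P : Type*} [LE P] (rk : P → ℤ) (Φ : Flag P) (i : ℤ) : P ≃o P :=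
  if IsRegular P then reflGen rk Φ (i - 1) * reflGen rk Φ i
  else Classical.epsilon (IsChiralRotation rk Φ i)

/-- The family `σ₁, …, σₙ₋₁`; the index `k : Fin (n - 1)` stands for `k + 1`. -/
def rotGens (n : ℕ) {P : Type*} [LE P] (rk : P → ℤ) (Φ : Flag P) (k : Fin (n - 1)) : P ≃o P :=
  rotGen rk Φ ((k : ℤ) + 1)

/-- The group `Γ⁺(P) = ⟨σ₁, …, σₙ₋₁⟩` (for a chiral polytope this is the whole automorphism
group). -/
def rotGroup (n : ℕ) {P : Type*} [LE P] (rk : P → ℤ) (Φ : Flag P) : Subgroup (P ≃o P) :=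
  Subgroup.closure (Set.range (rotGens n rk Φ))

/-- Regular, and the rotation subgroup has index `2` in the automorphism group. -/
def IsDirectlyRegular (n : ℕ) {P : Type*} [LE P] (rk : P → ℤ) : Prop :=
  IsRegular P ∧ ∀ Φ : Flag P, (rotGroup n rk Φ).index = 2

/-- The Schläfli type `{p₁, …, pₙ₋₁}` of a regular or chiral polytope: `pⱼ` is the order of `σⱼ`
(the index `k : Fin (n - 1)` stands for `k + 1`). -/
def HasType (n : ℕ) {P : Type*} [LE P] (rk : P → ℤ) (p : Fin (n - 1) → ℕ) : Prop :=
  ∀ (Φ : Flag P) (k : Fin (n - 1)), orderOf (rotGens n rk Φ k) = p k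

/-! ### Total chirality -/

/-- The matrix of the string Coxeter group `W = [∞, …, ∞]`; the entry `0` stands for `∞`. -/
def stringMatrix (n : ℕ) : CoxeterMatrix (Fin n) where
  M := Matrix.of fun i j =>
    if i = j then 1 else if (i : ℕ) + 1 = j ∨ (j : ℕ) + 1 = i then 0 else 2
  isSymm := by
    ext i j
    simp only [Matrix.transpose_apply, Matrix.of_apply, eq_comm (a := j) (b := i),
      or_comm (a := (j : ℕ) + 1 = i)]
  diagonal i := by simp
  off_diagonal i j h := by
    simp only [Matrix.of_apply, if_neg h]
    split_ifs <;> simp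

/-- The universal string Coxeter group `W` on generators `r₀, …, rₙ₋₁`. -/
abbrev UnivGroup (n : ℕ) : Type := (stringMatrix n).Group

/-- The elements `s₁, …, sₙ₋₁` of `W`, with `sᵢ = rᵢ₋₁rᵢ` (the index `k` stands for `k + 1`). -/
def univRot (n : ℕ) (k : Fin (n - 1)) : UnivGroup n :=
  (stringMatrix n).simple ⟨k, by omega⟩ * (stringMatrix n).simple ⟨k + 1, by omega⟩

/-- The rotation subgroup `W⁺ = ⟨s₁, …, sₙ₋₁⟩` of `W`. -/
def univRotGroup (n : ℕ) : Subgroup (UnivGroup n) :=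
  Subgroup.closure (Set.range (univRot n))

/-- The subgroup `M` of `W⁺` with `Γ⁺(P) = W⁺ / M`, that is, the kernel of `sᵢ ↦ σᵢ`: it consists
of the elements of `W` represented by those words in the `sᵢ` that become trivial when each `sᵢ` is
replaced by `σᵢ`. -/
def univKernel (n : ℕ) {P : Type*} [LE P] (rk : P → ℤ) (Φ : Flag P) : Subgroup (UnivGroup n) :=
  (FreeGroup.lift (rotGens n rk Φ)).ker.map (FreeGroup.lift (univRot n))

/-- `P` is totally chiral: the smallest normal subgroup of `W` containing `M` is `W⁺`.
(The condition does not depend on the base flag `Φ`.) -/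
def IsTotallyChiral (n : ℕ) {P : Type*} [LE P] (rk : P → ℤ) (Φ : Flag P) : Prop :=
  Subgroup.normalClosure (univKernel n rk Φ : Set (UnivGroup n)) = univRotGroup n

/-! ### Mixing -/

/-- The mix `⟨(α₁, α₁'), …, (αₘ, αₘ')⟩` of two groups with specified generators. -/
def mixGroup {m : ℕ} {G H : Type*} [Group G] [Group H] (α : Fin m → G) (α' : Fin m → H) :
    Subgroup (G × H) :=
  Subgroup.closure (Set.range fun k => (α k, α' k))

/-- The generators of the mix, as elements of the mix. -/
def mixGens {m : ℕ} {G H : Type*} [Group G] [Group H] (α : Fin m → G) (α' : Fin m → H)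
    (k : Fin m) : mixGroup α α' :=
  ⟨(α k, α' k), Subgroup.subset_closure ⟨k, rfl⟩⟩

/-- For a group with generators `s₁, …, sₙ₋₁` (the index `k` stands for `k + 1`), the subgroup
`Γⱼ` generated by the `sᵢ` with `i ≠ j, j + 1` together with `sⱼsⱼ₊₁`. -/
def faceSubgroup (n : ℕ) {G : Type*} [Group G] (s : Fin (n - 1) → G) (j : ℤ) : Subgroup G :=
  Subgroup.closure
    ({g | ∃ k : Fin (n - 1), (k : ℤ) + 1 ≠ j ∧ (k : ℤ) + 1 ≠ j + 1 ∧ g = s k} ∪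
      {g | ∃ k l : Fin (n - 1), (k : ℤ) + 1 = j ∧ (l : ℤ) + 1 = j + 1 ∧ g = s k * s l})

/-- The faces of the polytope associated with a group `G` with generators `s₁, …, sₙ₋₁`: the
`j`-faces are the left cosets of `Γⱼ`, for `j = -1, 0, …, n`. -/
def CosetGeometry (n : ℕ) {G : Type*} [Group G] (s : Fin (n - 1) → G) : Type _ :=
  Σ j : Set.Icc (-1 : ℤ) n, G ⧸ faceSubgroup n s j

/-- The rank of a coset of `Γⱼ` is `j`. -/
def CosetGeometry.rank (n : ℕ) {G : Type*} [Group G] (s : Fin (n - 1) → G)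
    (x : CosetGeometry n s) : ℤ := x.1

/-- Incidence: `φΓᵢ ≤ ψΓⱼ` if and only if `i ≤ j` and the two cosets intersect. -/
instance CosetGeometry.instLE (n : ℕ) {G : Type*} [Group G] (s : Fin (n - 1) → G) :
    LE (CosetGeometry n s) where
  le x y := x.1 ≤ y.1 ∧
    ∃ g : G, (QuotientGroup.mk g : G ⧸ faceSubgroup n s x.1) = x.2 ∧
      (QuotientGroup.mk g : G ⧸ faceSubgroup n s y.1) = y.2

/-- The mix of `P` and `Q` with respect to base flags `Φ` and `Ψ`: the structure associated with
the mix of `Γ⁺(P)` and `Γ⁺(Q)`. -/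
abbrev Mix (n : ℕ) {P Q : Type*} [LE P] [LE Q] (rkP : P → ℤ) (rkQ : Q → ℤ)
    (Φ : Flag P) (Ψ : Flag Q) : Type _ :=
  CosetGeometry n (mixGens (rotGens n rkP Φ) (rotGens n rkQ Ψ))

/-- The rank function of the mix. -/
abbrev mixRank (n : ℕ) {P Q : Type*} [LE P] [LE Q] (rkP : P → ℤ) (rkQ : Q → ℤ)
    (Φ : Flag P) (Ψ : Flag Q) : Mix n rkP rkQ Φ Ψ → ℤ :=
  CosetGeometry.rank n (mixGens (rotGens n rkP Φ) (rotGens n rkQ Ψ))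

/-- Some subgroup of `A` has a quotient isomorphic to `B`. -/
def HasSubgroupWithQuotient (A B : Type*) [Group A] [Group B] : Prop :=
  ∃ (H : Subgroup A) (N : Subgroup H) (_ : N.Normal), Nonempty (H ⧸ N ≃* B)

end

end AbsPoly

/-!
The mix is studied through its flags. The flags of an `n`-polytope form a set with commuting
involutions, the `i`-adjacency operations, on which the automorphisms act freely; strong
flag-connectedness says that two flags which share the faces with ranks outside `I` are joined by
changes of faces with ranks in `I`. Such a set with operations is an `IsFlagSystem`. Conversely, a
flag system determines a polytope, whose `j`-faces are the classes of flags under changes of faces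
of rank different from `j` (`IsIncidence.isPolytope`); the crux is the intersection property, and
it suffices to have it for intervals of ranks (`IsFlagSystem.conn_of_compl`).

Both a chiral and a directly regular polytope have a two-colouring of the flags which is preserved
by the rotation group and reversed by every adjacency (`isColoring_orbitColor`,
`isColoring_rotColor`). The flags of the mix are the pairs of flags of equal colour, with the
diagonal operations. For an interval of ranks, the even words in the operations are generated by
products of two consecutive ones. In such a product the two coordinates have coprime orders, so it
can be made in one coordinate alone. Therefore two pairs are joined within an interval as soon as
their coordinates are (`conn_matched_Ioo`), and the intersection property for intervals passes to
the mix (`isFlagSystem_matched`).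

The mix of the groups acts on these pairs, freely and transitively on each colour. Its subgroup
`Γⱼ` consists of the elements which move the base pair without a change of the `j`-face
(`conn_of_mem_faceSubgroup`, `exists_mem_faceSubgroup`), so that the coset geometry is the polytope
of this flag system (`isIncidence_cosetInc`). Here the rank has to be at least three, which follows
from chirality (`three_le_of_isChiral`). As the group is transitive on each colour class, the mix is
regular if some automorphism exchanges the colours, and chiral otherwise
(`isChiral_or_isDirectlyRegular`); the order of a rotation is the period of a flag under two
consecutive operations, which is the least common multiple of the periods of its coordinates.

If the mix is regular, let `K` be the kernel of the projection `G → Γ(P)` of its rotation group, and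
`K'` the conjugate of `K` under a reflection. Then `K K'` is normal in the full automorphism group.
The universal group `W` maps to the latter, and the preimage of `K K'` is a normal subgroup which
contains the kernel of `W⁺ → Γ(P)`; for totally chiral `P` it contains `W⁺`. Hence `K K' = G`, and
`G` is mapped onto `Γ(P) × Γ(P)` (`exists_surjective_of_isTotallyChiral`).
-/

namespace AbsPoly

open Set

/-! ### Flag systems -/

/-- `y` is reached from `x` by applying operations `r i` with `i ∈ I`. For flags and their
`i`-adjacency operations: `y` is reached from `x` by changing faces with ranks in `I`. -/
def Conn {X : Type*} (r : ℤ → X → X) (I : Set ℤ) : X → X → Prop :=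
  Relation.ReflTransGen fun x y => ∃ i ∈ I, y = r i x

namespace Conn

variable {X Y : Type*} {r : ℤ → X → X} {r' : ℤ → Y → Y} {I J : Set ℤ} {x y z : X}

theorem refl (x : X) : Conn r I x x := Relation.ReflTransGen.refl

theorem trans (h : Conn r I x y) (h' : Conn r I y z) : Conn r I x z :=
  Relation.ReflTransGen.trans h h'

theorem step {i : ℤ} (hi : i ∈ I) (x : X) : Conn r I x (r i x) :=
  Relation.ReflTransGen.single ⟨i, hi, rfl⟩

theorem tail {i : ℤ} (h : Conn r I x y) (hi : i ∈ I) : Conn r I x (r i y) :=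
  h.trans (step hi y)

theorem symm (hr : ∀ i x, r i (r i x) = x) (h : Conn r I x y) : Conn r I y x := by
  induction h with
  | refl => exact refl _
  | @tail b _ _ hs ih =>
    obtain ⟨i, hi, rfl⟩ := hs
    have h := step (r := r) hi (r i b)
    rw [hr] at h
    exact h.trans ih

theorem map {f : X → Y} (hf : ∀ i x, f (r i x) = r' i (f x)) (h : Conn r I x y) :
    Conn r' I (f x) (f y) := by
  induction h with
  | refl => exact refl _
  | tail _ hs ih =>
    obtain ⟨i, hi, rfl⟩ := hs
    rw [hf]
    exact ih.tail hi

theorem map_step {f : X → X} (hf : ∀ i ∈ I, ∀ x, f (r i x) = r i (f x)) (h : Conn r I x y) :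
    Conn r I (f x) (f y) := by
  induction h with
  | refl => exact refl _
  | tail _ hs ih =>
    obtain ⟨i, hi, rfl⟩ := hs
    rw [hf i hi]
    exact ih.tail hi

theorem mono (hIJ : I ⊆ J) (h : Conn r I x y) : Conn r J x y :=
  Relation.ReflTransGen.mono (fun _ _ ⟨i, hi, e⟩ => ⟨i, hIJ hi, e⟩) _ _ h

/-- If the operations with index in `A` commute with those with index in `B`, then the steps with
index in `A` can be made first. -/
theorem split {A B : Set ℤ} (hI : I ⊆ A ∪ B)
    (hc : ∀ a ∈ A, ∀ b ∈ B, ∀ x, r a (r b x) = r b (r a x)) (h : Conn r I x y) :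
    ∃ t, Conn r A x t ∧ Conn r B t y := by
  induction h with
  | refl => exact ⟨x, refl _, refl _⟩
  | tail _ hs ih =>
    obtain ⟨i, hi, rfl⟩ := hs
    obtain ⟨t, h1, h2⟩ := ih
    rcases hI hi with ha | hb
    · refine ⟨r i t, h1.tail ha, ?_⟩
      exact h2.map_step fun b hb x => hc i ha b hb x
    · exact ⟨t, h1, h2.tail hb⟩

end Conn

/-- An abstraction of the set of flags of an `n`-polytope, with `r i` for the operation which
replaces a flag by the `i`-adjacent one. Indices outside `0, …, n - 1` stand for the identity. Of
the intersection property only the case of intervals of ranks is required; the general case is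
`IsFlagSystem.conn_of_compl`. -/
structure IsFlagSystem (n : ℕ) {X : Type*} (r : ℤ → X → X) : Prop where
  invol : ∀ i x, r i (r i x) = x
  comm : ∀ i j x, i + 2 ≤ j → r i (r j x) = r j (r i x)
  ne : ∀ (i : ℤ) x, 0 ≤ i → i < n → r i x ≠ x
  eq_self : ∀ (i : ℤ) x, ¬ (0 ≤ i ∧ i < n) → r i x = x
  conn : ∀ x y, Conn r univ x y
  inter : ∀ a b x y, Conn r (Iio b) x y → Conn r (Ioi a) x y → Conn r (Ioo a b) x y

namespace IsFlagSystem

variable {n : ℕ} {X : Type*} {r : ℤ → X → X} (hr : IsFlagSystem n r)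
include hr

/-- Only the indices `0, …, n - 1` matter for connectedness. -/
theorem conn_mono {I J : Set ℤ} {x y : X} (hIJ : ∀ i ∈ I, 0 ≤ i → i < n → i ∈ J)
    (h : Conn r I x y) : Conn r J x y := by
  induction h with
  | refl => exact .refl _
  | tail _ hs ih =>
    obtain ⟨i, hi, rfl⟩ := hs
    by_cases hin : 0 ≤ i ∧ i < n
    · exact ih.tail (hIJ i hi hin.1 hin.2)
    · rwa [hr.eq_self i _ hin]

theorem split_lt {j : ℤ} {x y : X} (h : Conn r {j}ᶜ x y) :
    ∃ t, Conn r (Iio j) x t ∧ Conn r (Ioi j) t y := by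
  refine h.split (fun i (hi : i ≠ j) => lt_or_gt_of_ne hi) fun a ha b hb x => ?_
  rw [mem_Iio] at ha
  rw [mem_Ioi] at hb
  exact hr.comm a b x (by omega)

theorem split_gt {j : ℤ} {x y : X} (h : Conn r {j}ᶜ x y) :
    ∃ t, Conn r (Ioi j) x t ∧ Conn r (Iio j) t y := by
  refine h.split (fun i (hi : i ≠ j) => (lt_or_gt_of_ne hi).symm) fun a ha b hb x => ?_
  rw [mem_Ioi] at ha
  rw [mem_Iio] at hb
  exact (hr.comm b a x (by omega)).symm

/-- The intersection property for arbitrary sets of ranks. -/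
theorem conn_of_compl {I : Set ℤ} {x y : X} (h : ∀ j, j ∉ I → Conn r {j}ᶜ x y) :
    Conn r I x y := by
  -- Up to rank `m`, the flag `x` can be matched with `y` by steps in `I`; the remaining
  -- difference lies above the last rank `a` outside `I`.
  have key : ∀ m : ℤ, -1 ≤ m → ∃ a t, Ioc a m ⊆ I ∧ Conn r I x t ∧ Conn r (Ioi a) t y := by
    intro m hm
    induction m, hm using Int.leInduction with
    | base =>
      refine ⟨-1, x, by simp, .refl _, ?_⟩
      exact hr.conn_mono (fun i _ h0 _ => by rw [mem_Ioi]; omega) (hr.conn x y)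
    | succ m _ ih =>
      obtain ⟨a, t, hI, hxt, hty⟩ := ih
      by_cases hmI : m + 1 ∈ I
      · refine ⟨a, t, fun i hi => ?_, hxt, hty⟩
        rcases eq_or_ne i (m + 1) with rfl | hne
        · exact hmI
        · exact hI ⟨hi.1, by have := hi.2; omega⟩
      · have h1 : Conn r {m + 1}ᶜ t y :=
          ((hxt.mono fun i hi (hi' : i = m + 1) => hmI (hi' ▸ hi)).symm hr.invol).trans (h _ hmI)
        obtain ⟨u, htu, huy⟩ := hr.split_lt h1
        by_cases ham : a < m + 1
        · refine ⟨m + 1, u, by simp, hxt.trans ?_, huy⟩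
          have h2 : Conn r (Ioi a) t u :=
            hty.trans ((huy.mono fun i hi => ham.trans hi).symm hr.invol)
          exact (hr.inter a (m + 1) t u htu h2).mono fun i hi =>
            hI ⟨hi.1, by have := hi.2; omega⟩
        · exact ⟨a, t, fun i hi => absurd (hi.1.trans_le hi.2) (by omega), hxt, hty⟩
  obtain ⟨a, t, hI, hxt, hty⟩ := key n (by omega)
  exact hxt.trans (hr.conn_mono (fun i hi _ hin => hI ⟨hi, hin.le⟩) hty)

/-- A flag is determined by its faces. -/
theorem eq_of_forall_conn {x y : X} (h : ∀ j, Conn r {j}ᶜ x y) : x = y := by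
  have h0 : Conn r ∅ x y := hr.conn_of_compl fun j _ => h j
  induction h0 with
  | refl => rfl
  | tail _ hs _ => exact absurd hs (by simp)

end IsFlagSystem

/-- A two-colouring such that adjacent flags have different colours. -/
structure IsColoring (n : ℕ) {X : Type*} (r : ℤ → X → X) (c : X → Bool) : Prop where
  flip : ∀ (i : ℤ) x, 0 ≤ i → i < n → c (r i x) = !c x
  fix : ∀ (i : ℤ) x, ¬ (0 ≤ i ∧ i < n) → c (r i x) = c x

/-! ### The mix of two coloured flag systems -/

section Matched

variable {n : ℕ} {X Y : Type*} {r : ℤ → X → X} {r' : ℤ → Y → Y} {c : X → Bool} {d : Y → Bool}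

/-- The pairs of flags of equal colour. -/
abbrev Matched (c : X → Bool) (d : Y → Bool) : Type _ := {z : X × Y // c z.1 = d z.2}

/-- The diagonal operations on pairs of flags of equal colour. -/
def matchedOp (hc : IsColoring n r c) (hd : IsColoring n r' d) (i : ℤ) (z : Matched c d) :
    Matched c d :=
  ⟨(r i z.1.1, r' i z.1.2), by
    by_cases hi : 0 ≤ i ∧ i < n
    · rw [hc.flip i _ hi.1 hi.2, hd.flip i _ hi.1 hi.2, z.2]
    · rw [hc.fix i _ hi, hd.fix i _ hi, z.2]⟩

/-- The two operations `r (i + 1) ∘ r i` and `r' (i + 1) ∘ r' i` have coprime exponents. -/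
def CoprimePeriods (n : ℕ) (r : ℤ → X → X) (r' : ℤ → Y → Y) : Prop :=
  ∀ i : ℤ, 0 ≤ i → i + 1 < n → ∃ p q : ℕ, p.Coprime q ∧
    (∀ x, (fun x => r (i + 1) (r i x))^[p] x = x) ∧ ∀ y, (fun y => r' (i + 1) (r' i y))^[q] y = y

theorem iterate_eq_of_modEq_one {f : X → X} {p m : ℕ} (hf : ∀ x, f^[p] x = x) (hm : m ≡ 1 [MOD p])
    (x : X) : f^[m] x = f x := by
  have h : ∀ k, f^[k % p] x = f^[k] x := fun k =>
    Function.IsPeriodicPt.iterate_mod_apply (hf x) k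
  rw [← h m, hm, h 1, Function.iterate_one]

theorem iterate_eq_of_dvd {f : X → X} {p m : ℕ} (hf : ∀ x, f^[p] x = x) (hm : p ∣ m)
    (x : X) : f^[m] x = x := by
  obtain ⟨k, rfl⟩ := hm
  exact Function.IsPeriodicPt.mul_const (hf x) k

variable (hc : IsColoring n r c) (hd : IsColoring n r' d)

theorem coe_iterate_matchedOp (i : ℤ) (z : Matched c d) (k : ℕ) :
    ((fun z => matchedOp hc hd (i + 1) (matchedOp hc hd i z))^[k] z).1 =
      ((fun x => r (i + 1) (r i x))^[k] z.1.1, (fun y => r' (i + 1) (r' i y))^[k] z.1.2) := by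
  induction k with
  | zero => rfl
  | succ k ih =>
    rw [Prod.ext_iff] at ih
    rw [Function.iterate_succ_apply', Function.iterate_succ_apply', Function.iterate_succ_apply']
    exact Prod.ext (congrArg (fun x => r (i + 1) (r i x)) ih.1)
      (congrArg (fun x => r' (i + 1) (r' i x)) ih.2)

/-- With coprime exponents, a rotation can be made in the second coordinate alone. -/
theorem conn_matched_rotation (hpq : CoprimePeriods n r r') {I : Set ℤ} {i : ℤ} (hi : i ∈ I) (hi' : i + 1 ∈ I) (h0 : 0 ≤ i)
    (hn : i + 1 < n) (z w : Matched c d) (h1 : w.1.1 = z.1.1)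
    (h2 : w.1.2 = r' (i + 1) (r' i z.1.2)) : Conn (matchedOp hc hd) I z w := by
  obtain ⟨p, q, hco, hp, hq⟩ := hpq i h0 hn
  obtain ⟨m, hm0, hm1⟩ := Nat.chineseRemainder hco 0 1
  set f : Matched c d → Matched c d := fun z => matchedOp hc hd (i + 1) (matchedOp hc hd i z)
  have hconn : ∀ k, Conn (matchedOp hc hd) I z (f^[k] z) := by
    intro k
    induction k with
    | zero => exact .refl _
    | succ k ih =>
      rw [Function.iterate_succ_apply']
      exact (ih.tail hi).tail hi'
  have : w = f^[m] z := by
    apply Subtype.ext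
    rw [coe_iterate_matchedOp, iterate_eq_of_dvd hp ((Nat.modEq_zero_iff_dvd).1 hm0),
      iterate_eq_of_modEq_one hq hm1, ← h1, ← h2]
  rw [this]
  exact hconn m

/-- The second coordinate of any pair `(x, y)` in the mix can be changed to `y'` by steps in `I`
while `x` is kept. -/
def SecondMove (I : Set ℤ) (y y' : Y) : Prop :=
  d y = d y' ∧ ∀ z w : Matched c d, z.1.2 = y → w.1.2 = y' → w.1.1 = z.1.1 →
    Conn (matchedOp hc hd) I z w

variable {hc hd} {I : Set ℤ}

theorem SecondMove.refl (y : Y) : SecondMove hc hd I y y := by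
  refine ⟨rfl, fun z w h1 h2 h3 => ?_⟩
  have : w = z := Subtype.ext (Prod.ext h3 (h2.trans h1.symm))
  rw [this]
  exact .refl _

theorem SecondMove.trans {y y' y'' : Y} (h : SecondMove hc hd I y y')
    (h' : SecondMove hc hd I y' y'') : SecondMove hc hd I y y'' := by
  refine ⟨h.1.trans h'.1, fun z w h1 h2 h3 => ?_⟩
  have hz : c z.1.1 = d y' := by rw [z.2, h1, h.1]
  exact (h.2 z ⟨(z.1.1, y'), hz⟩ h1 rfl rfl).trans (h'.2 _ w rfl h2 h3)

theorem matchedOp_invol (hr : IsFlagSystem n r) (hr' : IsFlagSystem n r') (i : ℤ)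
    (z : Matched c d) : matchedOp hc hd i (matchedOp hc hd i z) = z :=
  Subtype.ext (Prod.ext (hr.invol i _) (hr'.invol i _))

theorem SecondMove.symm (hr : IsFlagSystem n r) (hr' : IsFlagSystem n r') {y y' : Y}
    (h : SecondMove hc hd I y y') : SecondMove hc hd I y' y :=
  ⟨h.1.symm, fun z w h1 h2 h3 => (h.2 w z h2 h1 h3.symm).symm (matchedOp_invol hr hr')⟩

theorem SecondMove.step (hr : IsFlagSystem n r) (hr' : IsFlagSystem n r') {y y' : Y} {i : ℤ}
    (hi : i ∈ I) (h : SecondMove hc hd I y y') : SecondMove hc hd I (r' i y) (r' i y') := by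
  constructor
  · by_cases hin : 0 ≤ i ∧ i < n
    · rw [hd.flip i _ hin.1 hin.2, hd.flip i _ hin.1 hin.2, h.1]
    · rw [hd.fix i _ hin, hd.fix i _ hin, h.1]
  · intro z w h1 h2 h3
    have hzw := h.2 (matchedOp hc hd i z) (matchedOp hc hd i w)
      (by change r' i z.1.2 = y; rw [h1, hr'.invol])
      (by change r' i w.1.2 = y'; rw [h2, hr'.invol])
      (by change r i w.1.1 = r i z.1.1; rw [h3])
    have := ((Conn.step hi z).trans hzw).tail hi
    rwa [matchedOp_invol hr hr'] at this

/-- Telescoping: `r' j (r' i y)` arises from `y` by products of two consecutive operations. -/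
theorem secondMove_of_le (hr' : IsFlagSystem n r')
    (hpq : CoprimePeriods n r r') {i j : ℤ} (hij : i ≤ j) (h0 : 0 ≤ i) (hn : j < n)
    (hI : Icc i j ⊆ I) (y : Y) : SecondMove hc hd I y (r' j (r' i y)) := by
  induction j, hij using Int.leInduction with
  | base =>
    rw [hr'.invol]
    exact .refl y
  | succ j hj ih =>
    have h1 := ih (by omega) fun k hk => hI ⟨hk.1, by have := hk.2; omega⟩
    refine h1.trans ?_
    have h2 : SecondMove hc hd I (r' j (r' i y)) (r' (j + 1) (r' j (r' j (r' i y)))) := by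
      constructor
      · rw [hd.flip (j + 1) _ (by omega) (by omega), hd.flip j _ (by omega) (by omega),
          hr'.invol]
      · intro z w e1 e2 e3
        exact conn_matched_rotation hc hd hpq (hI ⟨hj, by omega⟩) (hI ⟨by omega, le_rfl⟩)
          (by omega) (by omega) z w e3 (by rw [e2, e1])
    rwa [hr'.invol] at h2

theorem secondMove_rotation (hr : IsFlagSystem n r) (hr' : IsFlagSystem n r')
    (hpq : CoprimePeriods n r r') {a b i j : ℤ} (hi : i ∈ Ioo a b) (hj : j ∈ Ioo a b)
    (hi0 : 0 ≤ i) (hin : i < n) (hj0 : 0 ≤ j) (hjn : j < n) (y : Y) :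
    SecondMove hc hd (Ioo a b) y (r' j (r' i y)) := by
  rcases le_total i j with h | h
  · exact secondMove_of_le hr' hpq h hi0 hjn (Icc_subset_Ioo hi.1 hj.2) y
  · have := secondMove_of_le (hc := hc) (hd := hd) hr' hpq h hj0 hin
      (Icc_subset_Ioo hj.1 hi.2) (r' j (r' i y))
    rw [hr'.invol, hr'.invol] at this
    exact this.symm hr hr'

/-- Within an interval of ranks, any two flags of equal colour in the second coordinate can be
joined while the first coordinate is kept. -/
theorem secondMove_of_conn (hr : IsFlagSystem n r) (hr' : IsFlagSystem n r')
    (hpq : CoprimePeriods n r r') {a b : ℤ} {y y' : Y} (h : Conn r' (Ioo a b) y y')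
    (hy : d y = d y') : SecondMove hc hd (Ioo a b) y y' := by
  by_cases he : ∃ e ∈ Ioo a b, 0 ≤ e ∧ e < n
  · obtain ⟨e, he, he0, hen⟩ := he
    -- The parity of the number of steps is recorded by the choice between `y` and `r' e y`.
    have key : SecondMove hc hd (Ioo a b) y y' ∨ SecondMove hc hd (Ioo a b) (r' e y) y' := by
      clear hy
      induction h with
      | refl => exact .inl (.refl y)
      | @tail u _ _ hs ih =>
        obtain ⟨i, hi, rfl⟩ := hs
        by_cases hin : 0 ≤ i ∧ i < n
        · have hrot := secondMove_rotation (hc := hc) (hd := hd) hr hr' hpq he hi he0 hen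
            hin.1 hin.2 (r' e u)
          rw [hr'.invol] at hrot
          rcases ih with ih | ih
          · exact .inr ((ih.step hr hr' he).trans hrot)
          · have := ih.step hr hr' he
            rw [hr'.invol] at this
            exact .inl (this.trans hrot)
        · rwa [hr'.eq_self i _ hin]
    rcases key with h | h
    · exact h
    · have := h.1
      rw [hd.flip e y he0 hen, hy] at this
      simp at this
  · have h0 : Conn r' ∅ y y' := hr'.conn_mono (fun i hi h0 hn => he ⟨i, hi, h0, hn⟩) h
    have : y = y' := hr'.eq_of_forall_conn fun j => h0.mono (empty_subset _)
    rw [this]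
    exact .refl y'

/-- Within an interval of ranks, connectedness in the mix is connectedness of both coordinates:
follow a path in the first coordinate, then correct the second one. -/
theorem conn_matched_Ioo (hr : IsFlagSystem n r) (hr' : IsFlagSystem n r')
    (hpq : CoprimePeriods n r r') {a b : ℤ} {z w : Matched c d}
    (h1 : Conn r (Ioo a b) z.1.1 w.1.1) (h2 : Conn r' (Ioo a b) z.1.2 w.1.2) :
    Conn (matchedOp hc hd) (Ioo a b) z w := by
  have lift : ∀ x', Conn r (Ioo a b) z.1.1 x' →
      ∃ z' : Matched c d, z'.1.1 = x' ∧ Conn (matchedOp hc hd) (Ioo a b) z z' := by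
    intro x' h
    induction h with
    | refl => exact ⟨z, rfl, .refl z⟩
    | tail _ hs ih =>
      obtain ⟨i, hi, rfl⟩ := hs
      obtain ⟨z', rfl, h⟩ := ih
      exact ⟨matchedOp hc hd i z', rfl, h.tail hi⟩
  obtain ⟨z', hz', h⟩ := lift _ h1
  have h3 : Conn r' (Ioo a b) z.1.2 z'.1.2 :=
    h.map (f := fun u : Matched c d => u.1.2) fun _ _ => rfl
  have h4 := secondMove_of_conn (hc := hc) (hd := hd) hr hr' hpq ((h3.symm hr'.invol).trans h2)
    (by rw [← z'.2, ← w.2, hz'])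
  exact h.trans (h4.2 z' w rfl rfl hz'.symm)

/-- The mix of two coloured flag systems with coprime periods inherits the intersection
property, interval by interval. -/
theorem isFlagSystem_matched (hr : IsFlagSystem n r) (hr' : IsFlagSystem n r')
    (hpq : CoprimePeriods n r r') : IsFlagSystem n (matchedOp hc hd) where
  invol := matchedOp_invol hr hr'
  comm i j x hij := Subtype.ext (Prod.ext (hr.comm i j _ hij) (hr'.comm i j _ hij))
  ne i x h0 hn h := hr.ne i x.1.1 h0 hn (congrArg (fun z : Matched c d => z.1.1) h)
  eq_self i x h := Subtype.ext (Prod.ext (hr.eq_self i _ h) (hr'.eq_self i _ h))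
  conn x y :=
    (conn_matched_Ioo (a := -1) (b := n) hr hr' hpq
      (hr.conn_mono (fun _ _ h0 hn => ⟨by omega, hn⟩) (hr.conn _ _))
      (hr'.conn_mono (fun _ _ h0 hn => ⟨by omega, hn⟩) (hr'.conn _ _))).mono (subset_univ _)
  inter a b x y h1 h2 := by
    have p1 : ∀ i (u : Matched c d), (matchedOp hc hd i u).1.1 = r i u.1.1 := fun _ _ => rfl
    have p2 : ∀ i (u : Matched c d), (matchedOp hc hd i u).1.2 = r' i u.1.2 := fun _ _ => rfl
    exact conn_matched_Ioo hr hr' hpq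
      (hr.inter a b _ _ (h1.map (f := fun u : Matched c d => u.1.1) p1)
        (h2.map (f := fun u : Matched c d => u.1.1) p1))
      (hr'.inter a b _ _ (h1.map (f := fun u : Matched c d => u.1.2) p2)
        (h2.map (f := fun u : Matched c d => u.1.2) p2))

theorem isColoring_matched : IsColoring n (matchedOp hc hd) fun z => c z.1.1 :=
  ⟨fun i z => hc.flip i z.1.1, fun i z => hc.fix i z.1.1⟩

end Matched

/-! ### Flags of a polytope -/

namespace IsPolytope

variable {n : ℕ} {P : Type*} [LE P] {rk : P → ℤ} (hP : IsPolytope n rk)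
include hP

theorem rank_mem (F : P) : rk F ∈ Icc (-1 : ℤ) n := by
  rw [← hP.rank_range]
  exact mem_range_self F

theorem eq_of_rank_eq {X : Flag P} {F G : P} (hF : F ∈ X) (hG : G ∈ X) (h : rk F = rk G) :
    F = G := by
  by_contra hne
  rcases X.chain_le hF hG hne with hle | hle
  · exact (hP.rank_strictMono F G hle hne).ne h
  · exact (hP.rank_strictMono G F hle (Ne.symm hne)).ne' h

theorem le_of_rank_le {X : Flag P} {F G : P} (hF : F ∈ X) (hG : G ∈ X) (h : rk F ≤ rk G) :
    F ≤ G := by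
  rcases eq_or_ne F G with rfl | hne
  · exact hP.refl F
  rcases X.chain_le hF hG hne with hle | hle
  · exact hle
  · exact absurd (hP.rank_strictMono G F hle (Ne.symm hne)) (not_lt.2 h)

/-- A flag has a face of each rank. -/
theorem exists_mem_of_rank (X : Flag P) {i : ℤ} (h : -1 ≤ i) (h' : i ≤ n) :
    ∃ F ∈ X, rk F = i := by
  have hsub : rk '' (X : Set P) ⊆ Icc (-1 : ℤ) n := image_subset_iff.2 fun F _ => hP.rank_mem F
  have hinj : InjOn rk (X : Set P) := fun F hF G hG h => hP.eq_of_rank_eq hF hG h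
  have hcard : (rk '' (X : Set P)).ncard = n + 2 := by
    rw [hinj.ncard_image, hP.flag_ncard]
  have hI : (Icc (-1 : ℤ) n).ncard = n + 2 := by
    rw [← Nat.card_coe_set_eq]
    simp
    omega
  have heq := eq_of_subset_of_ncard_le hsub (by rw [hcard, hI]) (finite_Icc _ _)
  have hi : i ∈ rk '' (X : Set P) := heq ▸ ⟨h, h'⟩
  exact hi

/-- A chain with a face of each rank is a maximal chain. -/
theorem isMaxChain_of_rank {s : Set P} (hs : IsChain (· ≤ ·) s)
    (h : ∀ i : ℤ, -1 ≤ i → i ≤ n → ∃ F ∈ s, rk F = i) : IsMaxChain (· ≤ ·) s := by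
  refine ⟨hs, fun t ht hst => hst.antisymm fun G hG => ?_⟩
  obtain ⟨F, hF, hFG⟩ := h (rk G) (hP.rank_mem G).1 (hP.rank_mem G).2
  by_contra hGs
  have hne : F ≠ G := fun e => hGs (e ▸ hF)
  rcases ht (hst hF) hG hne with hle | hle
  · exact (hP.rank_strictMono F G hle hne).ne hFG
  · exact (hP.rank_strictMono G F hle (Ne.symm hne)).ne' hFG

omit hP in
theorem exists_flag_of_isChain {s : Set P} (hs : IsChain (· ≤ ·) s) :
    ∃ X : Flag P, ∀ F ∈ s, F ∈ X := by
  obtain ⟨M, hM, hsM⟩ := hs.exists_maxChain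
  exact ⟨Flag.ofIsMaxChain M hM, fun F hF => hsM hF⟩

omit hP in
theorem exists_flag_mem (F : P) : ∃ X : Flag P, F ∈ X := by
  obtain ⟨X, hX⟩ := exists_flag_of_isChain (s := {F}) IsChain.singleton
  exact ⟨X, hX F rfl⟩

omit hP in
theorem exists_flag_mem_mem {F G : P} (h : F ≤ G) : ∃ X : Flag P, F ∈ X ∧ G ∈ X := by
  obtain ⟨X, hX⟩ := exists_flag_of_isChain (s := {F, G}) (IsChain.pair h)
  exact ⟨X, hX F (by simp), hX G (by simp)⟩

omit hP in
theorem flag_eq_of_subset {X Y : Flag P} (h : ∀ F ∈ X, F ∈ Y) : X = Y :=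
  SetLike.coe_injective (X.max_chain' Y.chain_le h)

/-! ### Adjacent flags -/

omit hP in
theorem _root_.AbsPoly.IsAdj.symm {i : ℤ} {X Y : Flag P} (h : IsAdj rk i X Y) : IsAdj rk i Y X :=
  ⟨h.1.symm, fun F hF => (h.2 F hF).symm⟩

theorem isAdj_of_forall_mem {i : ℤ} {X Y : Flag P} (hne : X ≠ Y)
    (h : ∀ F ∈ X, rk F ≠ i → F ∈ Y) : IsAdj rk i X Y := by
  refine ⟨hne, fun F hF => ⟨fun hX => h F hX hF, fun hY => ?_⟩⟩
  obtain ⟨G, hG, hGF⟩ := hP.exists_mem_of_rank X (hP.rank_mem F).1 (hP.rank_mem F).2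
  rwa [hP.eq_of_rank_eq hY (h G hG (hGF ▸ hF)) hGF.symm]

/-- Of the two faces of rank `j` between `E` and `G`, one is the face other than `F`. -/
theorem eq_of_diamond {j : ℤ} {E F F' F'' G : P} (hE : rk E = j - 1) (hG : rk G = j + 1)
    (hF : rk F = j) (hF' : rk F' = j) (hF'' : rk F'' = j) (h1 : E ≤ F) (h2 : F ≤ G) (h1' : E ≤ F')
    (h2' : F' ≤ G) (h1'' : E ≤ F'') (h2'' : F'' ≤ G) (hne' : F' ≠ F) (hne'' : F'' ≠ F) :
    F' = F'' := by
  obtain ⟨a, b, _, hab⟩ := ncard_eq_two.1 (hP.diamond j E G (hP.trans _ _ _ h1 h2) hE hG)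
  have m : F ∈ ({a, b} : Set P) := hab ▸ ⟨hF, h1, h2⟩
  have m' : F' ∈ ({a, b} : Set P) := hab ▸ ⟨hF', h1', h2'⟩
  have m'' : F'' ∈ ({a, b} : Set P) := hab ▸ ⟨hF'', h1'', h2''⟩
  simp only [mem_insert_iff, mem_singleton_iff] at m m' m''
  grind

theorem eq_of_rank_neg_one {F G : P} (hF : rk F = -1) (hG : rk G = -1) : F = G := by
  obtain ⟨B, hB⟩ := hP.exists_least
  have key : ∀ F, rk F = -1 → B = F := by
    intro F hF
    by_contra hne
    have := hP.rank_strictMono _ _ (hB F) hne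
    have := (hP.rank_mem B).1
    omega
  rw [← key F hF, ← key G hG]

theorem eq_of_rank_top {F G : P} (hF : rk F = n) (hG : rk G = n) : F = G := by
  obtain ⟨T, hT⟩ := hP.exists_greatest
  have key : ∀ F, rk F = n → F = T := by
    intro F hF
    by_contra hne
    have := hP.rank_strictMono _ _ (hT F) hne
    have := (hP.rank_mem T).2
    omega
  rw [key F hF, key G hG]

theorem rank_of_isAdj {i : ℤ} {X Y : Flag P} (h : IsAdj rk i X Y) : 0 ≤ i ∧ i < n := by
  by_contra hi
  refine h.1 (flag_eq_of_subset fun F hF => ?_)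
  by_cases hFi : rk F = i
  · have hr := hP.rank_mem F
    obtain ⟨G, hG, hGF⟩ := hP.exists_mem_of_rank Y hr.1 hr.2
    have : i = -1 ∨ i = n := by have := hr.1; have := hr.2; omega
    have hFG : F = G := by
      rcases this with rfl | rfl
      · exact hP.eq_of_rank_neg_one hFi (hGF.trans hFi)
      · exact hP.eq_of_rank_top hFi (hGF.trans hFi)
    exact hFG ▸ hG
  · exact (h.2 F hFi).1 hF

theorem isAdj_unique {i : ℤ} {X Y Z : Flag P} (hY : IsAdj rk i X Y) (hZ : IsAdj rk i X Z) :
    Y = Z := by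
  obtain ⟨h0, hn⟩ := hP.rank_of_isAdj hY
  obtain ⟨E, hE, hEr⟩ := hP.exists_mem_of_rank X (i := i - 1) (by omega) (by omega)
  obtain ⟨G, hG, hGr⟩ := hP.exists_mem_of_rank X (i := i + 1) (by omega) (by omega)
  obtain ⟨F, hF, hFr⟩ := hP.exists_mem_of_rank X (i := i) (by omega) (by omega)
  have aux : ∀ V : Flag P, IsAdj rk i X V → ∀ F', rk F' = i → F' ∈ V →
      E ≤ F' ∧ F' ≤ G ∧ F' ≠ F := by
    intro V hV F' hF' hm
    refine ⟨hP.le_of_rank_le ((hV.2 E (by omega)).1 hE) hm (by omega),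
      hP.le_of_rank_le hm ((hV.2 G (by omega)).1 hG) (by omega), ?_⟩
    rintro rfl
    refine hV.1 (flag_eq_of_subset fun H hH => ?_)
    by_cases hHi : rk H = i
    · rwa [hP.eq_of_rank_eq hH hF (hHi.trans hFr.symm)]
    · exact (hV.2 H hHi).1 hH
  have hEF := hP.le_of_rank_le hE hF (by omega)
  have hFG := hP.le_of_rank_le hF hG (by omega)
  refine flag_eq_of_subset fun F' hF' => ?_
  by_cases hi : rk F' = i
  · obtain ⟨F'', hF'', hr''⟩ := hP.exists_mem_of_rank Z (i := i) (by omega) (by omega)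
    obtain ⟨a1, a2, a3⟩ := aux Y hY F' hi hF'
    obtain ⟨b1, b2, b3⟩ := aux Z hZ F'' hr'' hF''
    rwa [hP.eq_of_diamond hEr hGr hFr hi hr'' hEF hFG a1 a2 b1 b2 a3 b3]
  · exact (hZ.2 F' hi).1 ((hY.2 F' hi).2 hF')

theorem exists_isAdj {i : ℤ} (h0 : 0 ≤ i) (hn : i < n) (X : Flag P) : ∃ Y, IsAdj rk i X Y := by
  obtain ⟨E, hE, hEr⟩ := hP.exists_mem_of_rank X (i := i - 1) (by omega) (by omega)
  obtain ⟨G, hG, hGr⟩ := hP.exists_mem_of_rank X (i := i + 1) (by omega) (by omega)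
  obtain ⟨F, hF, hFr⟩ := hP.exists_mem_of_rank X (i := i) (by omega) (by omega)
  have hEF := hP.le_of_rank_le hE hF (by omega)
  have hFG := hP.le_of_rank_le hF hG (by omega)
  have hd := hP.diamond i E G (hP.trans _ _ _ hEF hFG) hEr hGr
  obtain ⟨F', ⟨hF'r, hEF', hF'G⟩, hne⟩ := exists_ne_of_one_lt_ncard (by rw [hd]; simp) F
  have hchain : IsChain (· ≤ ·) (insert F' {H | H ∈ X ∧ rk H ≠ i}) := by
    refine IsChain.insert (fun a ha b hb hab => X.chain_le ha.1 hb.1 hab) fun H hH _ => ?_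
    rcases lt_or_gt_of_ne hH.2 with h | h
    · exact .inr (hP.trans _ _ _ (hP.le_of_rank_le hH.1 hE (by omega)) hEF')
    · exact .inl (hP.trans _ _ _ hF'G (hP.le_of_rank_le hG hH.1 (by omega)))
  have hmax := hP.isMaxChain_of_rank hchain fun k hk hkn => by
    rcases eq_or_ne k i with rfl | hki
    · exact ⟨F', mem_insert _ _, hF'r⟩
    · obtain ⟨H, hH, hHr⟩ := hP.exists_mem_of_rank X hk hkn
      exact ⟨H, mem_insert_of_mem _ ⟨hH, hHr ▸ hki⟩, hHr⟩
  refine ⟨Flag.ofIsMaxChain _ hmax, ?_⟩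
  refine hP.isAdj_of_forall_mem (fun e => ?_) fun H hH hHr => mem_insert_of_mem _ ⟨hH, hHr⟩
  have : F' ∈ X := e ▸ mem_insert F' _
  exact hne (hP.eq_of_rank_eq this hF (hF'r.trans hFr.symm))

end IsPolytope

open Classical in
/-- The `i`-adjacent flag, or the flag itself if there is none (`i ≠ 0, …, n - 1`). -/
noncomputable def adj {P : Type*} [LE P] (rk : P → ℤ) (i : ℤ) (X : Flag P) : Flag P :=
  if h : ∃ Y, IsAdj rk i X Y then h.choose else X

namespace IsPolytope

variable {n : ℕ} {P : Type*} [LE P] {rk : P → ℤ} (hP : IsPolytope n rk)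
include hP

theorem isAdj_adj {i : ℤ} (h0 : 0 ≤ i) (hn : i < n) (X : Flag P) : IsAdj rk i X (adj rk i X) := by
  have h := hP.exists_isAdj h0 hn X
  rw [adj, dif_pos h]
  exact h.choose_spec

theorem adj_eq {i : ℤ} {X Y : Flag P} (h : IsAdj rk i X Y) : adj rk i X = Y := by
  obtain ⟨h0, hn⟩ := hP.rank_of_isAdj h
  exact hP.isAdj_unique (hP.isAdj_adj h0 hn X) h

theorem adj_eq_self {i : ℤ} (hi : ¬ (0 ≤ i ∧ i < n)) (X : Flag P) : adj rk i X = X := by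
  rw [adj, dif_neg]
  rintro ⟨Y, hY⟩
  exact hi (hP.rank_of_isAdj hY)

theorem mem_adj_iff {i : ℤ} {X : Flag P} {F : P} (hF : rk F ≠ i) : F ∈ adj rk i X ↔ F ∈ X := by
  by_cases hi : 0 ≤ i ∧ i < n
  · exact ((hP.isAdj_adj hi.1 hi.2 X).2 F hF).symm
  · rw [hP.adj_eq_self hi]

/-- The faces whose ranks lie outside `I` are kept by steps in `I`. -/
theorem mem_of_conn {I : Set ℤ} {X Y : Flag P} (h : Conn (adj rk) I X Y) {F : P} (hF : F ∈ X)
    (hI : rk F ∉ I) : F ∈ Y := by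
  induction h with
  | refl => exact hF
  | tail _ hs ih =>
    obtain ⟨i, hi, rfl⟩ := hs
    exact (hP.mem_adj_iff fun e => hI (e ▸ hi)).2 ih

/-- A form of strong flag-connectedness. -/
theorem conn_of_mem {I : Set ℤ} {X Y : Flag P} (h : ∀ F ∈ X, rk F ∉ I → F ∈ Y) :
    Conn (adj rk) I X Y := by
  have hpath := hP.strongly_flag_connected X Y
  have key : ∀ Z, Relation.ReflTransGen
      (fun U V : Flag P => Adjacent rk U V ∧ ∀ F : P, F ∈ X → F ∈ Y → F ∈ V) X Z →
      Conn (adj rk) I X Z ∧ ∀ F ∈ X, F ∈ Y → F ∈ Z := by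
    intro Z hZ
    induction hZ with
    | refl => exact ⟨.refl _, fun F hF _ => hF⟩
    | @tail U V _ hs ih =>
      obtain ⟨⟨i, hi⟩, hV⟩ := hs
      refine ⟨?_, hV⟩
      rw [← hP.adj_eq hi]
      refine ih.1.tail ?_
      by_contra hiI
      obtain ⟨h0, hn⟩ := hP.rank_of_isAdj hi
      obtain ⟨F, hF, hFr⟩ := hP.exists_mem_of_rank X (i := i) (by omega) (by omega)
      have hFY := h F hF (hFr ▸ hiI)
      refine hi.1 (flag_eq_of_subset fun H hH => ?_)
      by_cases hHi : rk H = i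
      · rw [hP.eq_of_rank_eq hH (ih.2 F hF hFY) (hHi.trans hFr.symm)]
        exact hV F hF hFY
      · exact (hi.2 H hHi).1 hH
  exact (key Y hpath).1

theorem adj_adj (i : ℤ) (X : Flag P) : adj rk i (adj rk i X) = X := by
  by_cases hi : 0 ≤ i ∧ i < n
  · exact hP.adj_eq (hP.isAdj_adj hi.1 hi.2 X).symm
  · rw [hP.adj_eq_self hi, hP.adj_eq_self hi]

theorem adj_comm {i j : ℤ} (hij : i + 2 ≤ j) (X : Flag P) :
    adj rk i (adj rk j X) = adj rk j (adj rk i X) := by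
  by_cases hi : 0 ≤ i ∧ i < n; swap
  · rw [hP.adj_eq_self hi, hP.adj_eq_self hi]
  by_cases hj : 0 ≤ j ∧ j < n; swap
  · rw [hP.adj_eq_self hj, hP.adj_eq_self hj]
  -- The `j`-faces of `adj j X` and `adj j (adj i X)` agree, by the diamond condition.
  have hXY := hP.isAdj_adj hi.1 hi.2 X
  have hYV := hP.isAdj_adj hj.1 hj.2 (adj rk i X)
  have hXZ := hP.isAdj_adj hj.1 hj.2 X
  set Y := adj rk i X
  set V := adj rk j Y
  set Z := adj rk j X
  have hface : ∀ U W : Flag P, IsAdj rk j U W → ∀ F ∈ U, rk F = j → F ∉ W := by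
    intro U W hUW F hF hFj hFW
    refine hUW.1 (flag_eq_of_subset fun H hH => ?_)
    by_cases hHj : rk H = j
    · rwa [hP.eq_of_rank_eq hH hF (hHj.trans hFj.symm)]
    · exact (hUW.2 H hHj).1 hH
  refine hP.adj_eq (hP.isAdj_of_forall_mem (fun e => ?_) fun F hF hFi => ?_)
  · obtain ⟨F, hF, hFr⟩ := hP.exists_mem_of_rank X (i := i) (by omega) (by omega)
    have hFZ : F ∈ Z := (hXZ.2 F (by omega)).1 hF
    rw [e] at hFZ
    have hFY : F ∈ Y := (hYV.2 F (by omega)).2 hFZ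
    refine hXY.1 (flag_eq_of_subset fun H hH => ?_)
    by_cases hHi : rk H = i
    · rwa [hP.eq_of_rank_eq hH hF (hHi.trans hFr.symm)]
    · exact (hXY.2 H hHi).1 hH
  · by_cases hFj : rk F = j
    · obtain ⟨E, hE, hEr⟩ := hP.exists_mem_of_rank X (i := j - 1) (by omega) (by omega)
      obtain ⟨G, hG, hGr⟩ := hP.exists_mem_of_rank X (i := j + 1) (by omega) (by omega)
      obtain ⟨H, hH, hHr⟩ := hP.exists_mem_of_rank X (i := j) (by omega) (by omega)
      obtain ⟨F', hF', hFr'⟩ := hP.exists_mem_of_rank V (i := j) (by omega) (by omega)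
      have hEZ := (hXZ.2 E (by omega)).1 hE
      have hGZ := (hXZ.2 G (by omega)).1 hG
      have hEV := (hYV.2 E (by omega)).1 ((hXY.2 E (by omega)).1 hE)
      have hGV := (hYV.2 G (by omega)).1 ((hXY.2 G (by omega)).1 hG)
      have hHY := (hXY.2 H (by omega)).1 hH
      have hne : F ≠ H := fun e => hface X Z hXZ H hH hHr (e ▸ hF)
      have hne' : F' ≠ H := fun e => hface Y V hYV H hHY hHr (e ▸ hF')
      rwa [hP.eq_of_diamond hEr hGr hHr hFj hFr' (hP.le_of_rank_le hE hH (by omega))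
        (hP.le_of_rank_le hH hG (by omega)) (hP.le_of_rank_le hEZ hF (by omega))
        (hP.le_of_rank_le hF hGZ (by omega)) (hP.le_of_rank_le hEV hF' (by omega))
        (hP.le_of_rank_le hF' hGV (by omega)) hne hne']
    · exact (hYV.2 F hFj).1 ((hXY.2 F hFi).1 ((hXZ.2 F hFj).2 hF))

theorem isFlagSystem : IsFlagSystem n (adj rk) where
  invol := hP.adj_adj
  comm i j X hij := hP.adj_comm hij X
  ne i X h0 hn := (hP.isAdj_adj h0 hn X).1.symm
  eq_self i X hi := hP.adj_eq_self hi X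
  conn X Y := hP.conn_of_mem fun F _ h => absurd (mem_univ _) h
  inter a b X Y h1 h2 := hP.conn_of_mem fun F hF h => by
    by_cases ha : rk F ∈ Ioi a
    · exact hP.mem_of_conn h1 hF fun hb => h ⟨ha, hb⟩
    · exact hP.mem_of_conn h2 hF ha

end IsPolytope

/-! ### Automorphisms -/

/-- The image of a flag under an automorphism. -/
def flagMap {P : Type*} [LE P] (g : P ≃o P) (X : Flag P) : Flag P :=
  Flag.ofIsMaxChain (g '' X) (X.maxChain.image g)

section flagMap

variable {P : Type*} [LE P] {rk : P → ℤ}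

theorem coe_flagMap (g : P ≃o P) (X : Flag P) : (flagMap g X : Set P) = g '' X := rfl

theorem mem_flagMap {g : P ≃o P} {X : Flag P} {F : P} (h : F ∈ X) : g F ∈ flagMap g X :=
  mem_image_of_mem g h

theorem flagMap_one (X : Flag P) : flagMap 1 X = X :=
  SetLike.coe_injective (by rw [coe_flagMap]; exact image_id _)

theorem flagMap_mul (g h : P ≃o P) (X : Flag P) : flagMap (g * h) X = flagMap g (flagMap h X) :=
  SetLike.coe_injective (by
    rw [coe_flagMap, coe_flagMap, coe_flagMap, ← image_comp]
    rfl)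

theorem sameOrbit_iff {X Y : Flag P} : SameOrbit X Y ↔ ∃ g : P ≃o P, flagMap g X = Y :=
  exists_congr fun g => by rw [← coe_flagMap, SetLike.coe_set_eq]

theorem flagMap_inv_eq {g : P ≃o P} {X Y : Flag P} (h : flagMap g X = Y) : flagMap g⁻¹ Y = X := by
  rw [← h, ← flagMap_mul, inv_mul_cancel, flagMap_one]

theorem SameOrbit.symm {X Y : Flag P} (h : SameOrbit X Y) : SameOrbit Y X := by
  obtain ⟨g, hg⟩ := sameOrbit_iff.1 h
  exact sameOrbit_iff.2 ⟨g⁻¹, flagMap_inv_eq hg⟩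

theorem SameOrbit.trans {X Y Z : Flag P} (h : SameOrbit X Y) (h' : SameOrbit Y Z) :
    SameOrbit X Z := by
  obtain ⟨g, rfl⟩ := sameOrbit_iff.1 h
  obtain ⟨g', rfl⟩ := sameOrbit_iff.1 h'
  exact sameOrbit_iff.2 ⟨g' * g, flagMap_mul _ _ _⟩

variable {n : ℕ} (hP : IsPolytope n rk)
include hP

theorem IsPolytope.rank_le_rank_apply (g : P ≃o P) (F : P) : rk F ≤ rk (g F) := by
  have key : ∀ m : ℤ, -1 ≤ m → ∀ F : P, rk F = m → m ≤ rk (g F) := by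
    intro m hm
    induction m, hm using Int.leInduction with
    | base => exact fun F _ => (hP.rank_mem (g F)).1
    | succ m hm ih =>
      intro F hF
      obtain ⟨X, hX⟩ := IsPolytope.exists_flag_mem F
      have hn := (hP.rank_mem F).2
      obtain ⟨E, hE, hEr⟩ := hP.exists_mem_of_rank X (i := m) (by omega) (by omega)
      have hEF : E ≠ F := by rintro rfl; omega
      have h1 := hP.rank_strictMono (g E) (g F)
        (g.map_rel_iff.2 (hP.le_of_rank_le hE hX (by omega))) (g.injective.ne hEF)
      have h2 := ih E hEr
      omega
  exact key _ (hP.rank_mem F).1 F rfl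

/-- Automorphisms preserve the rank. -/
theorem IsPolytope.rank_apply (g : P ≃o P) (F : P) : rk (g F) = rk F := by
  refine le_antisymm ?_ (hP.rank_le_rank_apply g F)
  have := hP.rank_le_rank_apply g⁻¹ (g F)
  rwa [RelIso.inv_apply_self] at this

theorem IsPolytope.flagMap_adj (g : P ≃o P) (i : ℤ) (X : Flag P) :
    flagMap g (adj rk i X) = adj rk i (flagMap g X) := by
  by_cases hi : 0 ≤ i ∧ i < n
  · refine (hP.adj_eq ?_).symm
    have h := hP.isAdj_adj hi.1 hi.2 X
    refine hP.isAdj_of_forall_mem (fun e => h.1 ?_) fun F hF hFi => ?_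
    · exact (flagMap_inv_eq rfl).symm.trans
        ((congrArg (flagMap g⁻¹) e).trans (flagMap_inv_eq rfl))
    · obtain ⟨E, hE, rfl⟩ := hF
      rw [hP.rank_apply] at hFi
      exact mem_flagMap ((h.2 E hFi).1 hE)
  · rw [hP.adj_eq_self hi, hP.adj_eq_self hi]

/-- An automorphism which fixes a flag is trivial. -/
theorem IsPolytope.eq_one_of_flagMap_eq {g : P ≃o P} {X : Flag P} (h : flagMap g X = X) :
    g = 1 := by
  have key : ∀ Y, Conn (adj rk) univ X Y → flagMap g Y = Y := by
    intro Y hY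
    induction hY with
    | refl => exact h
    | tail _ hs ih =>
      obtain ⟨i, _, rfl⟩ := hs
      rw [hP.flagMap_adj, ih]
  ext F
  obtain ⟨Y, hY⟩ := IsPolytope.exists_flag_mem F
  have h1 : g F ∈ Y := by
    have h1 := mem_flagMap (g := g) hY
    rwa [key Y (hP.isFlagSystem.conn X Y)] at h1
  exact hP.eq_of_rank_eq h1 hY (hP.rank_apply g F)

theorem IsPolytope.eq_of_flagMap_eq {g h : P ≃o P} {X : Flag P} (e : flagMap g X = flagMap h X) :
    g = h := by
  have : flagMap (h⁻¹ * g) X = X := by rw [flagMap_mul, e, flagMap_inv_eq rfl]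
  exact (inv_mul_eq_one.1 (hP.eq_one_of_flagMap_eq this)).symm

end flagMap

/-! ### The polytope of a flag system -/

/-- The relation `inc` between the elements of a flag system and the ranked set `C` identifies the
faces of rank `j` with the classes of flags under `Conn r {j}ᶜ`, and two faces are incident if and
only if they share a flag. -/
structure IsIncidence (n : ℕ) {X C : Type*} [LE C] (r : ℤ → X → X) (rk : C → ℤ)
    (inc : X → C → Prop) : Prop where
  rank_mem : ∀ F, rk F ∈ Icc (-1 : ℤ) n
  exists_flag : ∀ F, ∃ x, inc x F
  exists_face : ∀ x (j : ℤ), -1 ≤ j → j ≤ n → ∃ F, rk F = j ∧ inc x F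
  conn : ∀ x y F, inc x F → inc y F → Conn r {rk F}ᶜ x y
  of_conn : ∀ x y F, inc x F → Conn r {rk F}ᶜ x y → inc y F
  eq : ∀ x F G, inc x F → inc x G → rk F = rk G → F = G
  le_iff : ∀ F G, F ≤ G ↔ rk F ≤ rk G ∧ ∃ x, inc x F ∧ inc x G

namespace IsIncidence

variable {n : ℕ} {X C : Type*} [LE C] {r : ℤ → X → X} {rk : C → ℤ} {inc : X → C → Prop}
  (hr : IsFlagSystem n r) (hi : IsIncidence n r rk inc)

include hi in
theorem isChain (x : X) : IsChain (· ≤ ·) {F | inc x F} := by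
  intro F hF G hG _
  rcases le_total (rk F) (rk G) with h | h
  · exact .inl ((hi.le_iff F G).2 ⟨h, x, hF, hG⟩)
  · exact .inr ((hi.le_iff G F).2 ⟨h, x, hG, hF⟩)

include hi in
theorem eq_of_mem_chain {S : Set C} (hS : IsChain (· ≤ ·) S) {F G : C} (hF : F ∈ S) (hG : G ∈ S)
    (h : rk F = rk G) : F = G := by
  by_contra hne
  rcases hS hF hG hne with hle | hle
  · obtain ⟨_, x, h1, h2⟩ := (hi.le_iff _ _).1 hle
    exact hne (hi.eq x F G h1 h2 h)
  · obtain ⟨_, x, h1, h2⟩ := (hi.le_iff _ _).1 hle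
    exact hne (hi.eq x F G h2 h1 h)

include hr hi

/-- Every chain of faces is contained in the set of faces of some `x`. -/
theorem exists_of_isChain [Nonempty X] {S : Set C} (hS : IsChain (· ≤ ·) S) :
    ∃ x, ∀ F ∈ S, inc x F := by
  have key : ∀ m : ℤ, -2 ≤ m → ∃ x, ∀ F ∈ S, rk F ≤ m → inc x F := by
    intro m hm
    induction m, hm using Int.leInduction with
    | base =>
      exact ⟨Classical.arbitrary X, fun F _ h => absurd (hi.rank_mem F).1 (by omega)⟩
    | succ m _ ih =>
      obtain ⟨x, hx⟩ := ih
      by_cases h0 : ∃ F₀ ∈ S, rk F₀ = m + 1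
      · obtain ⟨F₀, hF₀, hr₀⟩ := h0
        have htop : ∀ F ∈ S, rk F ≤ m + 1 → rk F ≤ m ∨ F = F₀ := by
          intro F hF hFm
          rcases eq_or_ne (rk F) (m + 1) with h | h
          · exact .inr (hi.eq_of_mem_chain hS hF hF₀ (h.trans hr₀.symm))
          · exact .inl (by omega)
        by_cases hlow : ∃ i, ∃ F ∈ S, rk F ≤ m ∧ rk F = i
        · -- Splice: the part up to the face `G` next below `F₀` from `x`, the part above from `u`.
          obtain ⟨i, ⟨G, hG, hGm, rfl⟩, hmax⟩ := Int.exists_greatest_of_bdd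
            (P := fun i => ∃ F ∈ S, rk F ≤ m ∧ rk F = i)
            ⟨m, fun i ⟨F, _, h1, h2⟩ => h2 ▸ h1⟩ hlow
          have hle : G ≤ F₀ := by
            rcases hS hG hF₀ (by rintro rfl; omega) with h | h
            · exact h
            · have := ((hi.le_iff _ _).1 h).1
              omega
          obtain ⟨_, u, huG, huF₀⟩ := (hi.le_iff _ _).1 hle
          obtain ⟨t, hxt, htu⟩ := hr.split_gt (hi.conn x u G (hx G hG hGm) huG)
          refine ⟨t, fun F hF hFm => ?_⟩
          rcases htop F hF hFm with h | rfl
          · refine hi.of_conn x t F (hx F hF h) (hxt.mono fun k hk hk' => ?_)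
            have h1 := hmax _ ⟨F, hF, h, rfl⟩
            rw [mem_Ioi, hk'] at hk
            omega
          · refine hi.of_conn u t F huF₀ ((htu.symm hr.invol).mono fun k hk hk' => ?_)
            rw [mem_Iio, hk'] at hk
            omega
        · obtain ⟨u, hu⟩ := hi.exists_flag F₀
          refine ⟨u, fun F hF hFm => ?_⟩
          rcases htop F hF hFm with h | rfl
          · exact absurd ⟨_, F, hF, h, rfl⟩ hlow
          · exact hu
      · refine ⟨x, fun F hF hFm => hx F hF ?_⟩
        have : rk F ≠ m + 1 := fun h => h0 ⟨F, hF, h⟩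
        omega
  obtain ⟨x, hx⟩ := key n (by omega)
  exact ⟨x, fun F hF => hx F hF (hi.rank_mem F).2⟩

theorem isMaxChain (x : X) : IsMaxChain (· ≤ ·) {F | inc x F} := by
  refine ⟨hi.isChain x, fun t ht hst => hst.antisymm fun F hF => ?_⟩
  have : Nonempty X := ⟨x⟩
  obtain ⟨y, hy⟩ := hi.exists_of_isChain hr ht
  obtain ⟨F', hF', hxF'⟩ := hi.exists_face x (rk F) (hi.rank_mem F).1 (hi.rank_mem F).2
  rwa [hi.eq y F F' (hy F hF) (hy F' (hst hxF')) hF'.symm]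

omit hr hi in
/-- The flag of the faces incident with `x`. -/
def flagOf (hr : IsFlagSystem n r) (hi : IsIncidence n r rk inc) (x : X) : Flag C :=
  Flag.ofIsMaxChain _ (hi.isMaxChain hr x)

theorem flagOf_surjective [Nonempty X] (Φ : Flag C) : ∃ x, hi.flagOf hr x = Φ := by
  obtain ⟨x, hx⟩ := hi.exists_of_isChain hr Φ.chain_le
  exact ⟨x, (IsPolytope.flag_eq_of_subset hx).symm⟩

theorem flagOf_injective {x y : X} (h : hi.flagOf hr x = hi.flagOf hr y) : x = y := by
  refine hr.eq_of_forall_conn fun j => ?_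
  by_cases hj : -1 ≤ j ∧ j ≤ n
  · obtain ⟨F, rfl, hF⟩ := hi.exists_face x j hj.1 hj.2
    have hF' : F ∈ hi.flagOf hr x := hF
    rw [h] at hF'
    exact hi.conn x y F hF hF'
  · refine hr.conn_mono (fun k _ h0 hn => ?_) (hr.conn x y)
    rintro rfl
    omega

theorem isAdj_flagOf {i : ℤ} (h0 : 0 ≤ i) (hn : i < n) (x : X) :
    IsAdj rk i (hi.flagOf hr x) (hi.flagOf hr (r i x)) := by
  refine ⟨fun h => hr.ne i x h0 hn (hi.flagOf_injective hr h).symm, fun F hF => ?_⟩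
  have hmem : i ∈ ({rk F}ᶜ : Set ℤ) := fun h => hF (mem_singleton_iff.1 h).symm
  exact ⟨fun h => hi.of_conn _ _ F h (.step hmem x),
    fun h => hi.of_conn _ _ F h ((Conn.step hmem x).symm hr.invol)⟩

theorem trans {F G H : C} (h : F ≤ G) (h' : G ≤ H) : F ≤ H := by
  obtain ⟨hFG, u, huF, huG⟩ := (hi.le_iff _ _).1 h
  obtain ⟨hGH, v, hvG, hvH⟩ := (hi.le_iff _ _).1 h'
  obtain ⟨t, hut, htv⟩ := hr.split_gt (hi.conn u v G huG hvG)
  refine (hi.le_iff _ _).2 ⟨hFG.trans hGH, t, ?_, ?_⟩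
  · exact hi.of_conn u t F huF (hut.mono fun k hk hk' => absurd (hk' ▸ hk : rk F ∈ Ioi (rk G))
      (not_lt.2 hFG))
  · exact hi.of_conn v t H hvH ((htv.symm hr.invol).mono fun k hk hk' =>
      absurd (hk' ▸ hk : rk H ∈ Iio (rk G)) (not_lt.2 hGH))

/-- If `u` is a flag through `F` and `G`, the two faces of rank `j` between `F` and `G` are those of
`u` and of `r j u`. -/
theorem diamond {j : ℤ} {F G : C} (hFG : F ≤ G) (hF : rk F = j - 1) (hG : rk G = j + 1) :
    {H : C | rk H = j ∧ F ≤ H ∧ H ≤ G}.ncard = 2 := by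
  obtain ⟨_, u, huF, huG⟩ := (hi.le_iff _ _).1 hFG
  have : Nonempty X := ⟨u⟩
  have hj0 : 0 ≤ j := by have := (hi.rank_mem F).1; omega
  have hjn : j < n := by have := (hi.rank_mem G).2; omega
  have hne : ∀ k, k ≠ j → j ∈ ({k}ᶜ : Set ℤ) := fun k hk h => hk (mem_singleton_iff.1 h).symm
  have hvF : inc (r j u) F := hi.of_conn _ _ F huF (.step (hne _ (by omega)) u)
  have hvG : inc (r j u) G := hi.of_conn _ _ G huG (.step (hne _ (by omega)) u)
  obtain ⟨A, hA, huA⟩ := hi.exists_face u j (by omega) (by omega)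
  obtain ⟨B, hB, hvB⟩ := hi.exists_face (r j u) j (by omega) (by omega)
  rw [ncard_eq_two]
  refine ⟨A, B, ?_, ?_⟩
  · rintro rfl
    refine hr.ne j u hj0 hjn (hr.eq_of_forall_conn fun k => ?_)
    rcases eq_or_ne k j with rfl | hk
    · have h := hi.conn _ _ A hvB huA
      rwa [hA] at h
    · exact (Conn.step (hne k hk) u).symm hr.invol
  · ext H
    constructor
    · rintro ⟨hH, hFH, hHG⟩
      have hchain : IsChain (· ≤ ·) ({F, H, G} : Set C) := by
        rintro a ha b hb hab
        simp only [mem_insert_iff, mem_singleton_iff] at ha hb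
        rcases ha with rfl | rfl | rfl <;> rcases hb with rfl | rfl | rfl <;> simp_all
      obtain ⟨x, hx⟩ := hi.exists_of_isChain hr hchain
      have hxF := hi.conn u x F huF (hx F (by simp))
      have hxG := hi.conn u x G huG (hx G (by simp))
      have hconn : Conn r {j - 1, j + 1}ᶜ u x := by
        refine hr.conn_of_compl fun k hk => ?_
        rw [notMem_compl_iff] at hk
        rcases hk with rfl | hk
        · rwa [← hF]
        · rw [mem_singleton_iff.1 hk, ← hG]
          exact hxG
      obtain ⟨t, hut, htx⟩ := hconn.split (A := {j}) (B := {j - 1, j, j + 1}ᶜ)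
        (fun k hk => by
          simp only [mem_compl_iff, mem_insert_iff, mem_singleton_iff, mem_union] at hk ⊢
          tauto)
        (fun a ha b hb y => by
          simp only [mem_compl_iff, mem_insert_iff, mem_singleton_iff] at ha hb
          rcases lt_or_ge a b with h | h
          · exact hr.comm a b y (by omega)
          · exact (hr.comm b a y (by omega)).symm)
      have ht : t = u ∨ t = r j u := by
        clear htx
        induction hut with
        | refl => exact .inl rfl
        | tail _ hs ih =>
          obtain ⟨k, rfl, rfl⟩ := hs
          rcases ih with rfl | rfl
          · exact .inr rfl
          · exact .inl (hr.invol _ _)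
      have htH : inc t H := by
        refine hi.of_conn x t H (hx H (by simp)) ((htx.symm hr.invol).mono fun k hk hk' => ?_)
        rw [hH, mem_singleton_iff] at hk'
        simp [hk'] at hk
      rcases ht with rfl | rfl
      · exact .inl (hi.eq _ H A htH huA (hH.trans hA.symm))
      · exact .inr (hi.eq _ H B htH hvB (hH.trans hB.symm))
    · rintro (rfl | rfl)
      · exact ⟨hA, (hi.le_iff _ _).2 ⟨by omega, u, huF, huA⟩,
          (hi.le_iff _ _).2 ⟨by omega, u, huA, huG⟩⟩
      · exact ⟨hB, (hi.le_iff _ _).2 ⟨by omega, _, hvF, hvB⟩,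
          (hi.le_iff _ _).2 ⟨by omega, _, hvB, hvG⟩⟩

theorem isPolytope [Nonempty X] : IsPolytope n rk where
  refl F := by
    obtain ⟨x, hx⟩ := hi.exists_flag F
    exact (hi.le_iff F F).2 ⟨le_rfl, x, hx, hx⟩
  trans _ _ _ := hi.trans hr
  antisymm F G h h' := by
    obtain ⟨h1, x, hF, hG⟩ := (hi.le_iff _ _).1 h
    exact hi.eq x F G hF hG (h1.antisymm ((hi.le_iff _ _).1 h').1)
  rank_strictMono F G h hne := by
    obtain ⟨h1, x, hF, hG⟩ := (hi.le_iff _ _).1 h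
    exact lt_of_le_of_ne h1 fun e => hne (hi.eq x F G hF hG e)
  rank_range := by
    refine Subset.antisymm (range_subset_iff.2 hi.rank_mem) fun j hj => ?_
    obtain ⟨F, hF, _⟩ := hi.exists_face (Classical.arbitrary X) j hj.1 hj.2
    exact ⟨F, hF⟩
  exists_least := by
    obtain ⟨F, hF, hx⟩ := hi.exists_face (Classical.arbitrary X) (-1) le_rfl (by omega)
    refine ⟨F, fun G => (hi.le_iff F G).2 ⟨hF ▸ (hi.rank_mem G).1, ?_⟩⟩
    obtain ⟨y, hy⟩ := hi.exists_flag G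
    refine ⟨y, hi.of_conn _ y F hx (hr.conn_mono (fun k _ h0 _ h => ?_) (hr.conn _ y)), hy⟩
    rw [hF, mem_singleton_iff] at h
    omega
  exists_greatest := by
    obtain ⟨F, hF, hx⟩ := hi.exists_face (Classical.arbitrary X) n (by omega) le_rfl
    refine ⟨F, fun G => (hi.le_iff G F).2 ⟨hF ▸ (hi.rank_mem G).2, ?_⟩⟩
    obtain ⟨y, hy⟩ := hi.exists_flag G
    refine ⟨y, hy, hi.of_conn _ y F hx (hr.conn_mono (fun k _ _ hn h => ?_) (hr.conn _ y))⟩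
    rw [hF, mem_singleton_iff] at h
    omega
  flag_ncard Φ := by
    obtain ⟨x, rfl⟩ := hi.flagOf_surjective hr Φ
    have hinj : InjOn rk (hi.flagOf hr x : Set C) := fun F hF G hG h => hi.eq x F G hF hG h
    have himg : rk '' (hi.flagOf hr x : Set C) = Icc (-1 : ℤ) n := by
      refine Subset.antisymm (image_subset_iff.2 fun F _ => hi.rank_mem F) fun j hj => ?_
      obtain ⟨F, hF, hxF⟩ := hi.exists_face x j hj.1 hj.2
      exact ⟨F, hxF, hF⟩
    rw [← hinj.ncard_image, himg, ← Nat.card_coe_set_eq]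
    simp
    omega
  strongly_flag_connected Φ Ψ := by
    obtain ⟨x, rfl⟩ := hi.flagOf_surjective hr Φ
    obtain ⟨y, rfl⟩ := hi.flagOf_surjective hr Ψ
    have hconn : Conn r {j | 0 ≤ j ∧ j < n ∧ ∀ F, inc x F → inc y F → rk F ≠ j} x y := by
      refine hr.conn_of_compl fun j hj => ?_
      by_cases hjn : 0 ≤ j ∧ j < n
      · have : ∃ F, inc x F ∧ inc y F ∧ rk F = j := by
          by_contra hcon
          exact hj ⟨hjn.1, hjn.2, fun F h1 h2 h3 => hcon ⟨F, h1, h2, h3⟩⟩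
        obtain ⟨F, h1, h2, rfl⟩ := this
        exact hi.conn x y F h1 h2
      · refine hr.conn_mono (fun k _ h0 hn => ?_) (hr.conn x y)
        rintro rfl
        omega
    have key : ∀ z, Conn r {j | 0 ≤ j ∧ j < n ∧ ∀ F, inc x F → inc y F → rk F ≠ j} x z →
        Relation.ReflTransGen (fun U V : Flag C => Adjacent rk U V ∧
          ∀ F : C, F ∈ hi.flagOf hr x → F ∈ hi.flagOf hr y → F ∈ V)
          (hi.flagOf hr x) (hi.flagOf hr z) := by
      intro z hz
      induction hz with
      | refl => exact .refl
      | @tail u v hxu hs ih =>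
        obtain ⟨i, hiI, rfl⟩ := hs
        refine ih.tail ⟨⟨i, hi.isAdj_flagOf hr hiI.1 hiI.2.1 u⟩, fun F hFx hFy => ?_⟩
        refine hi.of_conn x _ F hFx (Conn.mono (fun k hk hk' => ?_) (Conn.tail hxu hiI))
        exact hk.2.2 F hFx hFy (mem_singleton_iff.1 hk').symm
    exact key y hconn
  diamond j F G := hi.diamond hr

theorem adj_flagOf (i : ℤ) (x : X) :
    adj rk i (hi.flagOf hr x) = hi.flagOf hr (r i x) := by
  have : Nonempty X := ⟨x⟩
  by_cases h : 0 ≤ i ∧ i < n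
  · exact (hi.isPolytope hr).adj_eq (hi.isAdj_flagOf hr h.1 h.2 x)
  · rw [(hi.isPolytope hr).adj_eq_self h, hr.eq_self i x h]

end IsIncidence

/-! ### Groups generated by rotations -/

/-- The group `G` acts on a flag system, commuting with the operations `r i` and freely at the base
flag `o`, and the element `s k` (which stands for `sₖ₊₁`) moves `o` as the rotation does. -/
structure IsRotaryAction (n : ℕ) {X G : Type*} [Group G] (r : ℤ → X → X) (act : G → X → X) (o : X)
    (s : Fin (n - 1) → G) : Prop where
  one_act : ∀ x, act 1 x = x
  mul_act : ∀ g h x, act (g * h) x = act g (act h x)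
  act_comm : ∀ g i x, act g (r i x) = r i (act g x)
  free : ∀ g, act g o = o → g = 1
  gen : ∀ k : Fin (n - 1), act (s k) o = r ((k : ℤ) + 1) (r k o)

namespace IsRotaryAction

variable {n : ℕ} {X G : Type*} [Group G] {r : ℤ → X → X} {act : G → X → X} {o : X}
  {s : Fin (n - 1) → G} {c : X → Bool}
  (hr : IsFlagSystem n r) (hc : IsColoring n r c) (ha : IsRotaryAction n r act o s)

include ha

theorem inv_act (g : G) (x : X) : act g⁻¹ (act g x) = x := by
  rw [← ha.mul_act, inv_mul_cancel, ha.one_act]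

theorem act_inv (g : G) (x : X) : act g (act g⁻¹ x) = x := by
  rw [← ha.mul_act, mul_inv_cancel, ha.one_act]

theorem conn_act {I : Set ℤ} {x y : X} (g : G) (h : Conn r I x y) :
    Conn r I (act g x) (act g y) :=
  h.map (ha.act_comm g)

theorem eq_of_act_eq {g h : G} (e : act g o = act h o) : g = h := by
  have : act (h⁻¹ * g) o = o := by rw [ha.mul_act, e, ha.inv_act]
  exact (inv_mul_eq_one.1 (ha.free _ this)).symm

include hr in
/-- The elements of `faceSubgroup n s j` fix the `j`-face of the base flag. -/
theorem conn_of_mem_faceSubgroup {j : ℤ} {g : G} (hg : g ∈ faceSubgroup n s j) :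
    Conn r {j}ᶜ o (act g o) := by
  induction hg using Subgroup.closure_induction with
  | mem g hg =>
    rcases hg with ⟨k, h1, h2, rfl⟩ | ⟨k, l, h1, h2, rfl⟩
    · rw [ha.gen]
      have hk : (k : ℤ) ∈ ({j}ᶜ : Set ℤ) := fun h => h2 (by rw [mem_singleton_iff.1 h])
      exact (Conn.step hk o).tail h1
    · have e1 : (l : ℤ) = (k : ℤ) + 1 := by omega
      rw [ha.mul_act, ha.gen l, ha.act_comm, ha.act_comm, ha.gen k, e1, hr.invol, h1]
      have hk : (k : ℤ) ∈ ({j}ᶜ : Set ℤ) := fun h => by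
        have := mem_singleton_iff.1 h
        omega
      have hj : j + 1 ∈ ({j}ᶜ : Set ℤ) := fun h => by
        have := mem_singleton_iff.1 h
        omega
      exact (Conn.step hk o).tail hj
  | one =>
    rw [ha.one_act]
    exact .refl o
  | mul g h _ _ ihg ihh =>
    rw [ha.mul_act]
    exact ihg.trans (ha.conn_act g ihh)
  | inv g _ ih =>
    have := ha.conn_act g⁻¹ ih
    rw [ha.inv_act] at this
    exact this.symm hr.invol

include hr hc in
theorem color_act_of_base {g : G} (h : c (act g o) = c o) (x : X) : c (act g x) = c x := by
  have hx := hr.conn o x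
  induction hx with
  | refl => exact h
  | tail _ hs ih =>
    obtain ⟨i, _, rfl⟩ := hs
    rw [ha.act_comm]
    by_cases hi : 0 ≤ i ∧ i < n
    · rw [hc.flip i _ hi.1 hi.2, hc.flip i _ hi.1 hi.2, ih]
    · rw [hc.fix i _ hi, hc.fix i _ hi, ih]

include hr hc in
theorem color_act {g : G} (hg : g ∈ Subgroup.closure (range s)) (x : X) :
    c (act g x) = c x := by
  induction hg using Subgroup.closure_induction generalizing x with
  | mem g hg =>
    obtain ⟨k, rfl⟩ := hg
    refine ha.color_act_of_base hr hc ?_ x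
    have := k.2
    rw [ha.gen, hc.flip _ _ (by omega) (by omega), hc.flip _ _ (by omega) (by omega),
      Bool.not_not]
  | one => rw [ha.one_act]
  | mul g h _ _ ihg ihh => rw [ha.mul_act, ihg, ihh]
  | inv g _ ih => rw [← ih, ha.act_inv]

omit ha in
theorem faceSubgroup_le_closure (j : ℤ) :
    faceSubgroup n s j ≤ Subgroup.closure (range s) := by
  refine (Subgroup.closure_le _).2 ?_
  rintro g (⟨k, _, _, rfl⟩ | ⟨k, l, _, _, rfl⟩)
  · exact Subgroup.subset_closure (mem_range_self k)
  · exact mul_mem (Subgroup.subset_closure (mem_range_self k))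
      (Subgroup.subset_closure (mem_range_self l))

include hr in
/-- Two consecutive changes, of the faces of ranks `i'` and `i`, of the base flag are made by an
element of `faceSubgroup n s j`, if `i` and `i'` are different from `j`. -/
theorem exists_act_eq_pair (hn : 2 ≤ n) {j : ℤ} {e : ℤ} (he : e = if j = 0 then 1 else 0) {i : ℤ}
    (hi0 : 0 ≤ i) (hin : i < n) (hij : i ≠ j) :
    ∃ g ∈ faceSubgroup n s j, r i (r e o) = act g o := by
  have step : ∀ i i' : ℤ, (∃ g ∈ faceSubgroup n s j, r i (r e o) = act g o) →
      (∃ g ∈ faceSubgroup n s j, r i' (r i o) = act g o) →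
      ∃ g ∈ faceSubgroup n s j, r i' (r e o) = act g o := by
    rintro i i' ⟨g, hg, h⟩ ⟨g', hg', h'⟩
    refine ⟨g * g', mul_mem hg hg', ?_⟩
    rw [ha.mul_act, ← h', ha.act_comm, ha.act_comm, ← h, hr.invol]
  have pair : ∀ k : ℤ, 0 ≤ k → k + 1 < n → k ≠ j → k + 1 ≠ j →
      ∃ g ∈ faceSubgroup n s j, r (k + 1) (r k o) = act g o := by
    intro k h0 hk h1 h2
    lift k to ℕ using h0
    refine ⟨s ⟨k, by omega⟩, Subgroup.subset_closure (.inl ⟨_, h2, ?_, rfl⟩),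
      (ha.gen ⟨k, by omega⟩).symm⟩
    simpa using h1
  -- A gap at rank `j` is bridged by the half-turn `sⱼ sⱼ₊₁`.
  have gap : 1 ≤ j → j + 1 < n →
      ∃ g ∈ faceSubgroup n s j, r (j + 1) (r (j - 1) o) = act g o := by
    intro h0 hj
    obtain ⟨k, rfl⟩ : ∃ k : ℕ, j = k + 1 := ⟨(j - 1).toNat, by omega⟩
    refine ⟨s ⟨k, by omega⟩ * s ⟨k + 1, by omega⟩,
      Subgroup.subset_closure (.inr ⟨_, _, rfl, by simp, rfl⟩), ?_⟩
    rw [ha.mul_act, ha.gen, ha.act_comm, ha.act_comm, ha.gen]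
    simp only [Nat.cast_add, Nat.cast_one, add_sub_cancel_right, hr.invol]
  have main : ∀ m : ℕ, ∀ i : ℤ, i ≤ m → e ≤ i → i < n → i ≠ j →
      ∃ g ∈ faceSubgroup n s j, r i (r e o) = act g o := by
    intro m
    induction m with
    | zero =>
      intro i hm hei hin hij
      obtain rfl : i = e := by split_ifs at he <;> omega
      exact ⟨1, one_mem _, by rw [hr.invol, ha.one_act]⟩
    | succ m ih =>
      intro i hm hei hin hij
      by_cases hei' : i = e
      · rw [hei']
        exact ⟨1, one_mem _, by rw [hr.invol, ha.one_act]⟩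
      by_cases h1 : i - 1 = j
      · refine step (j - 1) i (ih _ (by omega) (by split_ifs at he <;> omega) (by omega)
          (by omega)) ?_
        obtain rfl : i = j + 1 := by omega
        exact gap (by split_ifs at he <;> omega) hin
      · refine step (i - 1) i (ih _ (by omega) (by omega) (by omega) h1) ?_
        obtain ⟨k, rfl⟩ : ∃ k, i = k + 1 := ⟨i - 1, by ring⟩
        rw [add_sub_cancel_right] at h1 ⊢
        exact pair k (by split_ifs at he <;> omega) hin h1 hij
  exact main i.toNat i (by omega) (by split_ifs at he <;> omega) hin hij

include hr hc in
/-- The flags which are reached without a change of the `j`-face and have the colour of the base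
flag are the images of the base flag under `faceSubgroup n s j`. -/
theorem exists_mem_faceSubgroup (hn : 2 ≤ n) {j : ℤ} {z : X} (h : Conn r {j}ᶜ o z)
    (hz : c z = c o) : ∃ g ∈ faceSubgroup n s j, z = act g o := by
  obtain ⟨e, he⟩ : ∃ e : ℤ, e = if j = 0 then 1 else 0 := ⟨_, rfl⟩
  have he0 : 0 ≤ e := by split_ifs at he <;> omega
  have hen : e < n := by split_ifs at he <;> omega
  have key : ∃ g ∈ faceSubgroup n s j, z = act g o ∨ z = act g (r e o) := by
    clear hz
    induction h with
    | refl => exact ⟨1, one_mem _, .inl (ha.one_act o).symm⟩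
    | tail _ hs ih =>
      obtain ⟨i, hij, rfl⟩ := hs
      by_cases hi : 0 ≤ i ∧ i < n
      · obtain ⟨g', hg', h'⟩ := ha.exists_act_eq_pair hr hn he hi.1 hi.2
          (fun e => hij (mem_singleton_iff.2 e))
        obtain ⟨g, hg, rfl | rfl⟩ := ih
        · refine ⟨g * g'⁻¹, mul_mem hg (inv_mem hg'), .inr ?_⟩
          have h2 : r i o = act g'⁻¹ (r e o) := by
            rw [← ha.inv_act g' (r i o), ha.act_comm, ← h', hr.invol]
          rw [ha.mul_act, ← h2, ha.act_comm]
        · refine ⟨g * g', mul_mem hg hg', .inl ?_⟩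
          rw [ha.mul_act, ← h', ha.act_comm g i]
      · rwa [hr.eq_self i _ hi]
  obtain ⟨g, hg, rfl | rfl⟩ := key
  · exact ⟨g, hg, rfl⟩
  · rw [ha.color_act hr hc (faceSubgroup_le_closure j hg), hc.flip e o he0 hen] at hz
    simp at hz

include hr hc in
/-- The rotation group consists of the elements which preserve the colours. -/
theorem mem_closure_iff (hn : 2 ≤ n) {g : G} :
    g ∈ Subgroup.closure (range s) ↔ c (act g o) = c o := by
  refine ⟨fun hg => ha.color_act hr hc hg o, fun h => ?_⟩
  have hconn : Conn r {-1}ᶜ o (act g o) := by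
    refine hr.conn_mono (fun k _ h0 _ hk => ?_) (hr.conn o (act g o))
    rw [mem_singleton_iff] at hk
    omega
  obtain ⟨g', hg', e⟩ := ha.exists_mem_faceSubgroup hr hc hn hconn h
  rw [ha.eq_of_act_eq e]
  exact faceSubgroup_le_closure _ hg'

end IsRotaryAction

/-! ### The coset geometry -/

/-- The flag `z` is incident with the coset `gΓⱼ` if it arises from the translate `g o` of the base
flag without a change of the `j`-face. -/
def cosetInc (n : ℕ) {X G : Type*} [Group G] (r : ℤ → X → X) (act : G → X → X) (o : X)
    (s : Fin (n - 1) → G) (z : X) (F : CosetGeometry n s) : Prop :=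
  ∃ g : G, (QuotientGroup.mk g : G ⧸ faceSubgroup n s F.1) = F.2 ∧ Conn r {(F.1 : ℤ)}ᶜ z (act g o)

namespace IsRotaryAction

variable {n : ℕ} {X G : Type*} [Group G] {r : ℤ → X → X} {act : G → X → X} {o : X}
  {s : Fin (n - 1) → G} {c : X → Bool}
  (hr : IsFlagSystem n r) (hc : IsColoring n r c) (ha : IsRotaryAction n r act o s)
  (hn : 3 ≤ n) (hs : Subgroup.closure (range s) = ⊤)

include hr hc ha hn hs

omit hs in
/-- Every flag can be moved into the orbit of the base flag with two given faces kept: as `n ≥ 3`,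
there is a third rank. -/
theorem exists_conn_act (z : X) (i j : ℤ) :
    ∃ g : G, Conn r {i}ᶜ z (act g o) ∧ Conn r {j}ᶜ z (act g o) := by
  have orbit : ∀ w, c w = c o → ∃ g, w = act g o := by
    intro w hw
    have hconn : Conn r {-1}ᶜ o w := by
      refine hr.conn_mono (fun k _ h0 _ hk => ?_) (hr.conn o w)
      rw [mem_singleton_iff] at hk
      omega
    obtain ⟨g, _, e⟩ := ha.exists_mem_faceSubgroup hr hc (by omega) hconn hw
    exact ⟨g, e⟩
  by_cases hz : c z = c o
  · obtain ⟨g, rfl⟩ := orbit z hz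
    exact ⟨g, .refl _, .refl _⟩
  · obtain ⟨e, he0, hen, hei, hej⟩ : ∃ e : ℤ, 0 ≤ e ∧ e < n ∧ e ≠ i ∧ e ≠ j := by
      by_cases h0 : 0 ≠ i ∧ 0 ≠ j
      · exact ⟨0, le_rfl, by omega, h0⟩
      by_cases h1 : 1 ≠ i ∧ 1 ≠ j
      · exact ⟨1, by omega, by omega, h1⟩
      · exact ⟨2, by omega, by omega, by omega, by omega⟩
    obtain ⟨g, hg⟩ := orbit (r e z) (by
      rw [hc.flip e z he0 hen]
      revert hz
      cases c z <;> cases c o <;> simp)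
    exact ⟨g, hg ▸ .step hei z, hg ▸ .step hej z⟩

theorem isIncidence_cosetInc :
    IsIncidence n r (CosetGeometry.rank n s) (cosetInc n r act o s) where
  rank_mem F := F.1.2
  exists_flag F := by
    obtain ⟨g, hg⟩ := QuotientGroup.mk_surjective F.2
    exact ⟨act g o, g, hg, .refl _⟩
  exists_face z j h h' := by
    obtain ⟨g, hg, _⟩ := ha.exists_conn_act hr hc hn z j j
    exact ⟨⟨⟨j, h, h'⟩, QuotientGroup.mk g⟩, rfl, g, rfl, hg⟩
  conn x y F := by
    rintro ⟨g, hg, hx⟩ ⟨g', hg', hy⟩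
    have hmem : g⁻¹ * g' ∈ faceSubgroup n s F.1 := QuotientGroup.eq.1 (hg.trans hg'.symm)
    have h := ha.conn_act g (ha.conn_of_mem_faceSubgroup hr hmem)
    rw [← ha.mul_act, mul_inv_cancel_left] at h
    exact (hx.trans h).trans (hy.symm hr.invol)
  of_conn x y F := by
    rintro ⟨g, hg, hx⟩ h
    exact ⟨g, hg, (h.symm hr.invol).trans hx⟩
  eq x F G := by
    obtain ⟨j, F⟩ := F
    obtain ⟨k, G⟩ := G
    rintro ⟨g, hg, hx⟩ ⟨g', hg', hx'⟩ hjk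
    obtain rfl : j = k := Subtype.ext hjk
    dsimp only at hg hg' hx hx'
    rw [← hg, ← hg']
    refine congrArg (Sigma.mk j) (QuotientGroup.eq.2 ?_)
    have h := ha.conn_act g⁻¹ ((hx.symm hr.invol).trans hx')
    rw [ha.inv_act, ← ha.mul_act] at h
    obtain ⟨γ, hγ, e⟩ := ha.exists_mem_faceSubgroup hr hc (by omega) h
      (ha.color_act hr hc (hs ▸ Subgroup.mem_top _) o)
    rwa [ha.eq_of_act_eq e]
  le_iff F H := by
    constructor
    · rintro ⟨hle, g, hF, hH⟩
      exact ⟨hle, act g o, ⟨g, hF, .refl _⟩, ⟨g, hH, .refl _⟩⟩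
    · rintro ⟨hle, z, ⟨g, hg, hzF⟩, ⟨g', hg', hzH⟩⟩
      refine ⟨hle, ?_⟩
      obtain ⟨γ, h1, h2⟩ := ha.exists_conn_act hr hc hn z F.1 H.1
      have aux : ∀ (j : ℤ) (g : G), Conn r {j}ᶜ z (act g o) → Conn r {j}ᶜ z (act γ o) →
          (QuotientGroup.mk γ : G ⧸ faceSubgroup n s j) = QuotientGroup.mk g := by
        intro j g h h'
        have h3 := ha.conn_act γ⁻¹ ((h'.symm hr.invol).trans h)
        rw [ha.inv_act, ← ha.mul_act] at h3
        obtain ⟨δ, hδ, e⟩ := ha.exists_mem_faceSubgroup hr hc (by omega) h3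
          (ha.color_act hr hc (hs ▸ Subgroup.mem_top _) o)
        rw [QuotientGroup.eq, ha.eq_of_act_eq e]
        exact hδ
      exact ⟨γ, (aux _ g hzF h1).trans hg, (aux _ g' hzH h2).trans hg'⟩

end IsRotaryAction

/-- Left multiplication by `g` as an automorphism of the coset geometry. -/
def leftMul (n : ℕ) {G : Type*} [Group G] (s : Fin (n - 1) → G) :
    G →* (CosetGeometry n s ≃o CosetGeometry n s) where
  toFun g :=
    { toFun := fun F => ⟨F.1, g • F.2⟩
      invFun := fun F => ⟨F.1, g⁻¹ • F.2⟩
      left_inv := fun F => congrArg (Sigma.mk F.1) (inv_smul_smul g F.2)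
      right_inv := fun F => congrArg (Sigma.mk F.1) (smul_inv_smul g F.2)
      map_rel_iff' := by
        intro F H
        refine and_congr_right fun _ => ⟨?_, ?_⟩
        · rintro ⟨h, h1, h2⟩
          exact ⟨g⁻¹ * h, (congrArg (g⁻¹ • ·) h1).trans (inv_smul_smul g F.2),
            (congrArg (g⁻¹ • ·) h2).trans (inv_smul_smul g H.2)⟩
        · rintro ⟨h, h1, h2⟩
          exact ⟨g * h, congrArg (g • ·) h1, congrArg (g • ·) h2⟩ }
  map_one' := by
    ext F
    exact congrArg (Sigma.mk F.1) (one_smul _ F.2)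
  map_mul' g h := by
    ext F
    exact congrArg (Sigma.mk F.1) (mul_smul g h F.2)

theorem flagMap_leftMul {n : ℕ} {X G : Type*} [Group G] {r : ℤ → X → X} {act : G → X → X} {o : X}
    {s : Fin (n - 1) → G} (hr : IsFlagSystem n r) (ha : IsRotaryAction n r act o s)
    (hi : IsIncidence n r (CosetGeometry.rank n s) (cosetInc n r act o s)) (g : G) (z : X) :
    flagMap (leftMul n s g) (hi.flagOf hr z) = hi.flagOf hr (act g z) := by
  refine IsPolytope.flag_eq_of_subset ?_
  rintro _ ⟨F, ⟨h, hF, hconn⟩, rfl⟩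
  refine ⟨g * h, congrArg (g • ·) hF, ?_⟩
  rw [ha.mul_act]
  exact ha.conn_act g hconn

/-! ### Rotations of regular and chiral polytopes -/

theorem IsPolytope.isRotaryAction {n : ℕ} {P : Type*} [LE P] {rk : P → ℤ}
    (hP : IsPolytope n rk) {Φ : Flag P} {s : Fin (n - 1) → (P ≃o P)}
    (hs : ∀ k, flagMap (s k) Φ = adj rk ((k : ℤ) + 1) (adj rk k Φ)) :
    IsRotaryAction n (adj rk) flagMap Φ s where
  one_act := flagMap_one
  mul_act := flagMap_mul
  act_comm g i X := hP.flagMap_adj g i X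
  free _ h := hP.eq_one_of_flagMap_eq h
  gen := hs

section

variable {n : ℕ} {P : Type*} [LE P] {rk : P → ℤ}

theorem IsPolytope.sameOrbit_adj (hP : IsPolytope n rk) {X Y : Flag P} (i : ℤ)
    (h : SameOrbit X Y) : SameOrbit (adj rk i X) (adj rk i Y) := by
  obtain ⟨g, rfl⟩ := sameOrbit_iff.1 h
  exact sameOrbit_iff.2 ⟨g, hP.flagMap_adj g i X⟩

open Classical in
/-- The colouring of the flags of a chiral polytope by their orbits. -/
noncomputable def orbitColor (Φ X : Flag P) : Bool := decide (SameOrbit Φ X)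

theorem orbitColor_eq_true {Φ X : Flag P} : orbitColor Φ X = true ↔ SameOrbit Φ X := by
  simp [orbitColor]

theorem sameOrbit_refl (X : Flag P) : SameOrbit X X := sameOrbit_iff.2 ⟨1, flagMap_one X⟩

theorem IsPolytope.isColoring_orbitColor (hP : IsPolytope n rk) (hc : IsChiral rk) (Φ : Flag P) :
    IsColoring n (adj rk) (orbitColor Φ) where
  flip i X h0 hn := by
    have hadj := hc.2 _ _ ⟨i, hP.isAdj_adj h0 hn X⟩
    obtain ⟨A, B, _, hAB⟩ := hc.1
    -- There are only two orbits, so one of two flags in distinct orbits is in that of `Φ`.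
    have h1 : SameOrbit Φ X ∨ SameOrbit Φ (adj rk i X) := by
      rcases hAB Φ with h | h <;> rcases hAB X with h' | h' <;>
        rcases hAB (adj rk i X) with h'' | h''
      all_goals first
        | exact .inl (h.symm.trans h')
        | exact .inr (h.symm.trans h'')
        | exact absurd (h'.symm.trans h'') hadj
    have h2 : ¬ (SameOrbit Φ X ∧ SameOrbit Φ (adj rk i X)) := fun h => hadj (h.1.symm.trans h.2)
    simp only [orbitColor]
    by_cases h : SameOrbit Φ X <;> by_cases h' : SameOrbit Φ (adj rk i X) <;> simp_all
  fix i X h := by rw [hP.adj_eq_self h]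

/-- In a chiral polytope the characterization of the rotations by their action on faces
determines their action on the base flag. -/
theorem IsPolytope.flagMap_of_isChiralRotation (hP : IsPolytope n rk) (hc : IsChiral rk)
    {Φ : Flag P} {i : ℤ} (h1 : 1 ≤ i) (hn : i < n) {g : P ≃o P}
    (hg : IsChiralRotation rk Φ i g) : flagMap g Φ = adj rk i (adj rk (i - 1) Φ) := by
  have hadj := hP.isAdj_adj (by omega) hn Φ (i := i)
  obtain ⟨E, hE, hEr⟩ := hP.exists_mem_of_rank Φ (i := i - 1) (by omega) (by omega)
  obtain ⟨F, hF, hFr⟩ := hP.exists_mem_of_rank Φ (i := i) (by omega) (by omega)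
  obtain ⟨G, hG, hGr⟩ := hP.exists_mem_of_rank Φ (i := i + 1) (by omega) (by omega)
  have hmem : ∀ H ∈ flagMap g (adj rk i Φ), rk H ≠ i - 1 → H ∈ Φ := by
    rintro _ ⟨H, hH, rfl⟩ hr
    rw [hP.rank_apply] at hr
    by_cases hHi : rk H = i
    · rw [hg.2 E hE F hF G hG hEr hFr hGr H hHi ?_
        (hP.le_of_rank_le ((hadj.2 E (by omega)).1 hE) hH (by omega))
        (hP.le_of_rank_le hH ((hadj.2 G (by omega)).1 hG) (by omega))]
      · exact hF
      · rintro rfl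
        refine hadj.1 (IsPolytope.flag_eq_of_subset fun K hK => ?_)
        by_cases hKi : rk K = i
        · rwa [hP.eq_of_rank_eq hK hF (hKi.trans hFr.symm)]
        · exact (hadj.2 K hKi).1 hK
    · have hHΦ := (hadj.2 H hHi).2 hH
      rwa [hg.1 H hHΦ hr hHi]
  have hne : flagMap g (adj rk i Φ) ≠ Φ := fun e =>
    hc.2 Φ (adj rk i Φ) ⟨i, hadj⟩ (SameOrbit.symm (sameOrbit_iff.2 ⟨g, e⟩))
  have h2 := hP.adj_eq (hP.isAdj_of_forall_mem hne hmem).symm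
  rw [h2, hP.flagMap_adj, hP.adj_adj]

theorem IsPolytope.exists_isChiralRotation (hP : IsPolytope n rk) (hc : IsChiral rk)
    (Φ : Flag P) {i : ℤ} (h1 : 1 ≤ i) (hn : i < n) : ∃ g, IsChiralRotation rk Φ i g := by
  have hcol := hP.isColoring_orbitColor hc Φ
  have horb : SameOrbit Φ (adj rk i (adj rk (i - 1) Φ)) := by
    rw [← orbitColor_eq_true, hcol.flip _ _ (by omega) hn, hcol.flip _ _ (by omega) (by omega),
      Bool.not_not, orbitColor_eq_true]
    exact sameOrbit_refl Φ
  obtain ⟨g, hg⟩ := sameOrbit_iff.1 horb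
  refine ⟨g, fun F hF h h' => ?_, fun E hE F hF G hG hEr hFr hGr F' hF'r hne hEF' hF'G => ?_⟩
  · have h2 : F ∈ flagMap g Φ := by
      rw [hg]
      exact (hP.mem_adj_iff h').2 ((hP.mem_adj_iff h).2 hF)
    exact hP.eq_of_rank_eq (mem_flagMap hF) h2 (hP.rank_apply g F)
  · have hadj := hP.isAdj_adj (by omega) hn Φ (i := i)
    -- `F'` is the face of rank `i` of the `i`-adjacent flag.
    have hF' : F' ∈ adj rk i Φ := by
      obtain ⟨H, hH, hHr⟩ := hP.exists_mem_of_rank (adj rk i Φ) (i := i) (by omega) (by omega)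
      have hHF : H ≠ F := by
        rintro rfl
        refine hadj.1 (IsPolytope.flag_eq_of_subset fun K hK => ?_)
        by_cases hKi : rk K = i
        · rwa [hP.eq_of_rank_eq hK hF (hKi.trans hFr.symm)]
        · exact (hadj.2 K hKi).1 hK
      rwa [hP.eq_of_diamond hEr hGr hFr hF'r hHr (hP.le_of_rank_le hE hF (by omega))
        (hP.le_of_rank_le hF hG (by omega)) hEF' hF'G
        (hP.le_of_rank_le ((hadj.2 E (by omega)).1 hE) hH (by omega))
        (hP.le_of_rank_le hH ((hadj.2 G (by omega)).1 hG) (by omega)) hne hHF]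
    have h2 : flagMap g (adj rk i Φ) = adj rk (i - 1) Φ := by
      rw [hP.flagMap_adj, hg, hP.adj_adj]
    have h3 := mem_flagMap (g := g) hF'
    rw [h2] at h3
    exact hP.eq_of_rank_eq h3 ((hP.mem_adj_iff (by omega)).2 hF)
      ((hP.rank_apply g F').trans (hF'r.trans hFr.symm))

theorem IsPolytope.flagMap_reflGen (hP : IsPolytope n rk) (hreg : IsRegular P) (Φ : Flag P)
    {i : ℤ} (h0 : 0 ≤ i) (hn : i < n) : flagMap (reflGen rk Φ i) Φ = adj rk i Φ := by
  have hadj := hP.isAdj_adj h0 hn Φ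
  obtain ⟨g, hg⟩ := hreg Φ (adj rk i Φ)
  obtain ⟨Ψ, hΨ, h⟩ : IsReflection rk Φ i (reflGen rk Φ i) :=
    Classical.epsilon_spec (p := IsReflection rk Φ i) ⟨g, _, hadj, hg⟩
  rw [hP.adj_eq hΨ]
  exact SetLike.coe_injective h

/-- The rotation `σₖ₊₁` maps the base flag `Φ` to the `(k + 1)`-adjacent flag of its
`k`-adjacent flag. -/
theorem IsPolytope.flagMap_rotGens (hP : IsPolytope n rk) (h : IsRegular P ∨ IsChiral rk)
    (Φ : Flag P) (k : Fin (n - 1)) :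
    flagMap (rotGens n rk Φ k) Φ = adj rk ((k : ℤ) + 1) (adj rk k Φ) := by
  have hk := k.2
  by_cases hreg : IsRegular P
  · rw [rotGens, rotGen, if_pos hreg, add_sub_cancel_right, flagMap_mul,
      hP.flagMap_reflGen hreg Φ (by omega) (by omega), hP.flagMap_adj,
      hP.flagMap_reflGen hreg Φ (by omega) (by omega)]
  · have hc := h.resolve_left hreg
    rw [rotGens, rotGen, if_neg hreg]
    have := hP.flagMap_of_isChiralRotation hc (i := (k : ℤ) + 1) (by omega) (by omega)
      (Classical.epsilon_spec (hP.exists_isChiralRotation hc Φ (by omega) (by omega)))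
    rwa [add_sub_cancel_right] at this

theorem IsPolytope.isRotaryAction_rotGens (hP : IsPolytope n rk) (h : IsRegular P ∨ IsChiral rk)
    (Φ : Flag P) : IsRotaryAction n (adj rk) flagMap Φ (rotGens n rk Φ) :=
  hP.isRotaryAction (hP.flagMap_rotGens h Φ)

/-- The rotation group is the group of all automorphisms preserving a given colouring. -/
theorem IsPolytope.mem_rotGroup_iff (hP : IsPolytope n rk) (h : IsRegular P ∨ IsChiral rk)
    (hn : 2 ≤ n) {c : Flag P → Bool} (hc : IsColoring n (adj rk) c) (Φ : Flag P) {g : P ≃o P} :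
    g ∈ rotGroup n rk Φ ↔ c (flagMap g Φ) = c Φ :=
  (hP.isRotaryAction_rotGens h Φ).mem_closure_iff hP.isFlagSystem hc hn

theorem IsPolytope.rotGroup_eq_top (hP : IsPolytope n rk) (hc : IsChiral rk) (hn : 2 ≤ n)
    (Φ : Flag P) : rotGroup n rk Φ = ⊤ := by
  rw [eq_top_iff]
  intro g _
  rw [hP.mem_rotGroup_iff (.inr hc) hn (hP.isColoring_orbitColor hc Φ),
    orbitColor_eq_true.2 (sameOrbit_refl Φ), orbitColor_eq_true]
  exact sameOrbit_iff.2 ⟨g, rfl⟩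

/-- The powers of the rotation `σₖ₊₁` move the base flag along its polygonal section. -/
theorem IsPolytope.flagMap_rotGens_pow (hP : IsPolytope n rk) (h : IsRegular P ∨ IsChiral rk)
    (Φ : Flag P) (k : Fin (n - 1)) (m : ℕ) : flagMap (rotGens n rk Φ k ^ m) Φ =
      (fun X => adj rk ((k : ℤ) + 1) (adj rk k X))^[m] Φ := by
  induction m with
  | zero => exact flagMap_one Φ
  | succ m ih =>
    rw [Function.iterate_succ_apply', ← ih, pow_succ, flagMap_mul, hP.flagMap_rotGens h,
      hP.flagMap_adj, hP.flagMap_adj]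

/-- The order of a rotation is the period of the base flag under two consecutive operations. -/
theorem IsPolytope.iterate_eq_iff (hP : IsPolytope n rk) (h : IsRegular P ∨ IsChiral rk)
    (Φ : Flag P) (k : Fin (n - 1)) (m : ℕ) :
    (fun X => adj rk ((k : ℤ) + 1) (adj rk k X))^[m] Φ = Φ ↔ orderOf (rotGens n rk Φ k) ∣ m := by
  rw [← hP.flagMap_rotGens_pow h, orderOf_dvd_iff_pow_eq_one]
  exact ⟨fun e => hP.eq_one_of_flagMap_eq e, fun e => by rw [e, flagMap_one]⟩

open Classical in
/-- The colouring of the flags of a directly regular polytope by the orbits of the rotation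
group. -/
noncomputable def rotColor (n : ℕ) (rk : P → ℤ) (Φ X : Flag P) : Bool :=
  decide (∃ g ∈ rotGroup n rk Φ, flagMap g Φ = X)

theorem IsPolytope.rotColor_flagMap (hP : IsPolytope n rk) {Φ : Flag P} {g : P ≃o P} :
    rotColor n rk Φ (flagMap g Φ) = true ↔ g ∈ rotGroup n rk Φ := by
  have h : rotColor n rk Φ (flagMap g Φ) = true ↔
      ∃ g' ∈ rotGroup n rk Φ, flagMap g' Φ = flagMap g Φ := by simp [rotColor]
  refine h.trans ⟨fun ⟨g', hg', e⟩ => ?_, fun hg => ⟨g, hg, rfl⟩⟩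
  exact hP.eq_of_flagMap_eq e ▸ hg'

theorem IsPolytope.isColoring_rotColor (hP : IsPolytope n rk) (hd : IsDirectlyRegular n rk)
    (Φ : Flag P) : IsColoring n (adj rk) (rotColor n rk Φ) where
  flip i X h0 hn := by
    have hrefl := fun {j : ℤ} => hP.flagMap_reflGen hd.1 Φ (i := j)
    have hidx := hd.2 Φ
    have hmul := fun {a b : P ≃o P} => Subgroup.mul_mem_iff_of_index_two hidx (a := a) (b := b)
    -- All the reflections lie outside the rotation group or all lie inside it; the latter is
    -- impossible, since the reflections generate the full group.
    have hstep : ∀ m : ℕ, (m : ℤ) + 1 < n → (reflGen rk Φ m ∈ rotGroup n rk Φ ↔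
        reflGen rk Φ (m + 1 : ℕ) ∈ rotGroup n rk Φ) := by
      intro m hm
      have h1 : reflGen rk Φ m * reflGen rk Φ (m + 1 : ℕ) ∈ rotGroup n rk Φ := by
        have h2 : rotGens n rk Φ ⟨m, by omega⟩ ∈ rotGroup n rk Φ :=
          Subgroup.subset_closure (mem_range_self _)
        rw [rotGens, rotGen, if_pos hd.1] at h2
        simpa using h2
      exact hmul.1 h1
    have hall0 : ∀ m : ℕ, (m : ℤ) < n → (reflGen rk Φ (0 : ℕ) ∈ rotGroup n rk Φ ↔
        reflGen rk Φ m ∈ rotGroup n rk Φ) := by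
      intro m
      induction m with
      | zero => exact fun _ => Iff.rfl
      | succ m ih => exact fun hm => (ih (by omega)).trans (hstep m (by omega))
    have hout : ∀ j : ℤ, 0 ≤ j → j < n → reflGen rk Φ j ∉ rotGroup n rk Φ := by
      intro j hj0 hjn hj
      have hin : ∀ l : ℤ, 0 ≤ l → l < n → reflGen rk Φ l ∈ rotGroup n rk Φ := by
        intro l hl0 hln
        lift j to ℕ using hj0
        lift l to ℕ using hl0
        exact (hall0 l hln).1 ((hall0 j hjn).2 hj)
      have htop : rotGroup n rk Φ = ⊤ := by
        rw [eq_top_iff]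
        intro g _
        have key : ∀ Y, Conn (adj rk) univ Φ Y → ∃ g ∈ rotGroup n rk Φ, flagMap g Φ = Y := by
          intro Y hY
          induction hY with
          | refl => exact ⟨1, one_mem _, flagMap_one Φ⟩
          | tail _ hs ih =>
            obtain ⟨l, _, rfl⟩ := hs
            obtain ⟨g, hg, rfl⟩ := ih
            by_cases hl : 0 ≤ l ∧ l < n
            · refine ⟨g * reflGen rk Φ l, mul_mem hg (hin l hl.1 hl.2), ?_⟩
              rw [flagMap_mul, hrefl hl.1 hl.2, hP.flagMap_adj]
            · exact ⟨g, hg, (hP.adj_eq_self hl _).symm⟩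
        obtain ⟨g', hg', e⟩ := key _ (hP.isFlagSystem.conn Φ (flagMap g Φ))
        rwa [← hP.eq_of_flagMap_eq e]
      rw [htop, Subgroup.index_top] at hidx
      exact absurd hidx (by simp)
    obtain ⟨g, rfl⟩ := sameOrbit_iff.1 (hd.1 Φ X)
    rw [← hP.flagMap_adj, ← hrefl h0 hn, ← flagMap_mul, Bool.eq_iff_iff, hP.rotColor_flagMap,
      Bool.not_eq_true', ← Bool.not_eq_true, hP.rotColor_flagMap, hmul]
    have := hout i h0 hn
    tauto
  fix i X h := by rw [hP.adj_eq_self h]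

/-! ### Chiral polytopes have rank at least three -/

/-- An involution on the flags which commutes with adjacency is induced by an automorphism. -/
theorem IsPolytope.exists_orderIso_of_involution (hP : IsPolytope n rk) (α : Flag P → Flag P)
    (hα : ∀ i X, α (adj rk i X) = adj rk i (α X)) (hinv : ∀ X, α (α X) = X) :
    ∃ g : P ≃o P, ∀ X, flagMap g X = α X := by
  have hex : ∀ F : P, ∃ F', rk F' = rk F ∧ ∀ X : Flag P, F ∈ X → F' ∈ α X := by
    intro F
    obtain ⟨X, hX⟩ := IsPolytope.exists_flag_mem F
    obtain ⟨F', hF', hr⟩ := hP.exists_mem_of_rank (α X) (hP.rank_mem F).1 (hP.rank_mem F).2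
    refine ⟨F', hr, fun Y hY => ?_⟩
    have hXY : Conn (adj rk) {rk F}ᶜ X Y := hP.conn_of_mem fun H hH h => by
      rwa [hP.eq_of_rank_eq hH hX (by simpa using h)]
    exact hP.mem_of_conn (hXY.map hα) hF' (by simp [hr])
  choose φ hφr hφ using hex
  have hφφ : ∀ F, φ (φ F) = F := by
    intro F
    obtain ⟨X, hX⟩ := IsPolytope.exists_flag_mem F
    have h1 := hφ _ _ (hφ F X hX)
    rw [hinv] at h1
    exact hP.eq_of_rank_eq h1 hX ((hφr _).trans (hφr _))
  have hmono : ∀ F G, F ≤ G → φ F ≤ φ G := by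
    intro F G h
    obtain ⟨X, hF, hG⟩ := IsPolytope.exists_flag_mem_mem h
    refine hP.le_of_rank_le (hφ F X hF) (hφ G X hG) ?_
    rw [hφr, hφr]
    rcases eq_or_ne F G with rfl | hne
    · exact le_rfl
    · exact (hP.rank_strictMono F G h hne).le
  refine ⟨{ toFun := φ, invFun := φ, left_inv := hφφ, right_inv := hφφ,
            map_rel_iff' := fun {F G} => ⟨fun h => ?_, hmono F G⟩ }, fun X => ?_⟩
  · rw [← hφφ F, ← hφφ G]
    exact hmono _ _ h
  · refine IsPolytope.flag_eq_of_subset ?_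
    rintro _ ⟨F, hF, rfl⟩
    exact hφ F X hF

/-- In ranks one and two the automorphism group of a chiral polytope would be commutative. Then the
map `g Φ ↦ g⁻¹ Φ⁰`, `g Φ⁰ ↦ g⁻¹ Φ`, where `Φ⁰` is the `0`-adjacent flag, would be induced by an
automorphism, which maps `Φ` to an adjacent flag. -/
theorem IsPolytope.three_le_of_isChiral (hP : IsPolytope n rk) (hc : IsChiral rk) : 3 ≤ n := by
  by_contra hn
  obtain ⟨Φ, Ψ, hΦΨ, _⟩ := hc.1
  have hr := hP.isFlagSystem
  have hcol := hP.isColoring_orbitColor hc Φ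
  have hn0 : 0 < n := by
    by_contra h0
    have : Φ = Ψ := hr.eq_of_forall_conn fun j =>
      (hr.conn_mono (J := ∅) (fun i _ h h' => by omega) (hr.conn Φ Ψ)).mono (empty_subset _)
    exact hΦΨ (this ▸ sameOrbit_refl Φ)
  have hcomm : ∀ g h : P ≃o P, g * h = h * g := by
    rcases (by omega : n = 1 ∨ n = 2) with rfl | rfl
    · have hone : ∀ g : P ≃o P, g = 1 := by
        intro g
        have key : ∀ Y, Conn (adj rk) univ Φ Y → Y = Φ ∨ Y = adj rk 0 Φ := by
          intro Y hY
          induction hY with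
          | refl => exact .inl rfl
          | tail _ hs ih =>
            obtain ⟨i, _, rfl⟩ := hs
            by_cases hi : i = 0
            · subst hi
              rcases ih with rfl | rfl
              · exact .inr rfl
              · exact .inl (hr.invol 0 Φ)
            · rwa [hr.eq_self i _ (by push_cast; omega)]
        rcases key _ (hr.conn Φ (flagMap g Φ)) with h | h
        · exact hP.eq_one_of_flagMap_eq h
        · exact absurd (sameOrbit_iff.2 ⟨g, h⟩)
            (hc.2 _ _ ⟨0, hP.isAdj_adj le_rfl (by simp) Φ⟩)
      intro g h
      rw [hone g, hone h]
    · intro g h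
      have hsub : range (rotGens 2 rk Φ) ⊆ {rotGens 2 rk Φ ⟨0, by omega⟩} := by
        rintro _ ⟨k, rfl⟩
        exact congrArg _ (Fin.ext (by omega))
      have hmem : ∀ g : P ≃o P, g ∈ Subgroup.zpowers (rotGens 2 rk Φ ⟨0, by omega⟩) := by
        intro g
        have h1 : g ∈ rotGroup 2 rk Φ := hP.rotGroup_eq_top hc le_rfl Φ ▸ Subgroup.mem_top g
        rw [Subgroup.zpowers_eq_closure]
        exact Subgroup.closure_mono hsub h1
      obtain ⟨a, rfl⟩ := Subgroup.mem_zpowers_iff.1 (hmem g)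
      obtain ⟨b, rfl⟩ := Subgroup.mem_zpowers_iff.1 (hmem h)
      rw [← zpow_add, ← zpow_add, add_comm]
  have hcact : ∀ (g : P ≃o P) X, orbitColor Φ (flagMap g X) = orbitColor Φ X := by
    intro g X
    rw [Bool.eq_iff_iff, orbitColor_eq_true, orbitColor_eq_true]
    have h : SameOrbit X (flagMap g X) := sameOrbit_iff.2 ⟨g, rfl⟩
    exact ⟨fun h' => h'.trans h.symm, fun h' => h'.trans h⟩
  have hcΦ : orbitColor Φ Φ = true := orbitColor_eq_true.2 (sameOrbit_refl Φ)
  have hc0 : orbitColor Φ (adj rk 0 Φ) = false := by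
    rw [hcol.flip 0 Φ le_rfl (by omega), hcΦ, Bool.not_true]
  have hex : ∀ X, ∃ g : P ≃o P, X = flagMap g (if orbitColor Φ X then Φ else adj rk 0 Φ) := by
    intro X
    by_cases hX : orbitColor Φ X
    · obtain ⟨g, hg⟩ := sameOrbit_iff.1 (orbitColor_eq_true.1 hX)
      exact ⟨g, by rw [if_pos hX, hg]⟩
    · have h1 : orbitColor Φ (adj rk 0 X) = true := by
        rw [hcol.flip 0 X le_rfl (by omega)]
        simpa using hX
      obtain ⟨g, hg⟩ := sameOrbit_iff.1 (orbitColor_eq_true.1 h1)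
      exact ⟨g, by rw [if_neg hX, hP.flagMap_adj, hg, hr.invol]⟩
  choose γ hγ using hex
  set α : Flag P → Flag P := fun X =>
    flagMap (γ X)⁻¹ (if orbitColor Φ X then adj rk 0 Φ else Φ) with hαdef
  have hα1 : ∀ g, α (flagMap g Φ) = flagMap g⁻¹ (adj rk 0 Φ) := by
    intro g
    have hcg : orbitColor Φ (flagMap g Φ) = true := (hcact g Φ).trans hcΦ
    have h1 := hγ (flagMap g Φ)
    rw [if_pos hcg] at h1
    simp only [hαdef, hcg, if_true]
    rw [← hP.eq_of_flagMap_eq h1]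
  have hα2 : ∀ g, α (flagMap g (adj rk 0 Φ)) = flagMap g⁻¹ Φ := by
    intro g
    have hcg : orbitColor Φ (flagMap g (adj rk 0 Φ)) = false := (hcact g _).trans hc0
    have h1 := hγ (flagMap g (adj rk 0 Φ))
    rw [if_neg (by simp [hcg])] at h1
    simp only [hαdef, hcg]
    rw [← hP.eq_of_flagMap_eq h1]
    simp
  have hcases : ∀ X, ∃ g, X = flagMap g Φ ∨ X = flagMap g (adj rk 0 Φ) := by
    intro X
    refine ⟨γ X, ?_⟩
    have h1 := hγ X
    split_ifs at h1
    · exact .inl h1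
    · exact .inr h1
  have hαadj : ∀ i X, α (adj rk i X) = adj rk i (α X) := by
    intro i X
    by_cases hi : 0 ≤ i ∧ i < n
    · rcases (by omega : i = 0 ∨ i = 1) with rfl | rfl
      · obtain ⟨g, rfl | rfl⟩ := hcases X
        · rw [← hP.flagMap_adj, hα1, hα2, ← hP.flagMap_adj, hr.invol]
        · rw [← hP.flagMap_adj, hr.invol, hα1, hα2, ← hP.flagMap_adj]
      · have hσ : SameOrbit Φ (adj rk 1 (adj rk 0 Φ)) := by
          rw [← orbitColor_eq_true, hcol.flip 1 _ (by omega) hi.2, hc0, Bool.not_false]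
        obtain ⟨σ, hσ⟩ := sameOrbit_iff.1 hσ
        have h1 : adj rk 1 Φ = flagMap σ⁻¹ (adj rk 0 Φ) := by
          have h2 : flagMap σ (adj rk 1 Φ) = adj rk 0 Φ := by rw [hP.flagMap_adj, hσ, hr.invol]
          exact (flagMap_inv_eq h2).symm
        obtain ⟨g, rfl | rfl⟩ := hcases X
        · rw [← hP.flagMap_adj, h1, ← flagMap_mul, hα2, hα1, ← hP.flagMap_adj, ← hσ,
            ← flagMap_mul, mul_inv_rev, inv_inv, hcomm]
        · rw [← hP.flagMap_adj, ← hσ, ← flagMap_mul, hα1, hα2, ← hP.flagMap_adj, h1,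
            ← flagMap_mul, mul_inv_rev, hcomm]
    · rw [hr.eq_self i _ hi, hr.eq_self i _ hi]
  have hαinv : ∀ X, α (α X) = X := by
    intro X
    obtain ⟨g, rfl | rfl⟩ := hcases X
    · rw [hα1, hα2, inv_inv]
    · rw [hα2, hα1, inv_inv]
  obtain ⟨g, hg⟩ := hP.exists_orderIso_of_involution α hαadj hαinv
  refine hc.2 _ _ ⟨0, hP.isAdj_adj le_rfl (by omega) Φ⟩ (sameOrbit_iff.2 ⟨g, ?_⟩)
  have h1 := hα1 1
  rw [flagMap_one, inv_one, flagMap_one] at h1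
  rw [hg, h1]

end

/-! ### Polytopes with a group acting transitively on each colour class -/

section

variable {n : ℕ} {R : Type*} [LE R] {rk : R → ℤ}

theorem IsPolytope.color_flagMap (hR : IsPolytope n rk) {C : Flag R → Bool}
    (hC : IsColoring n (adj rk) C) {g : R ≃o R} {X : Flag R} (h : C (flagMap g X) = C X)
    (Y : Flag R) : C (flagMap g Y) = C Y := by
  have hY := hR.isFlagSystem.conn X Y
  induction hY with
  | refl => exact h
  | tail _ hs ih =>
    obtain ⟨i, _, rfl⟩ := hs
    rw [hR.flagMap_adj]
    by_cases hi : 0 ≤ i ∧ i < n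
    · rw [hC.flip i _ hi.1 hi.2, hC.flip i _ hi.1 hi.2, ih]
    · rw [hC.fix i _ hi, hC.fix i _ hi, ih]

/-- The group `G` acts faithfully on the polytope by automorphisms, and its orbit of the flag `Θ` is
a colour class of the flags. -/
structure IsHalfTransitive (n : ℕ) {R G : Type*} [LE R] [Group G] (rk : R → ℤ) (C : Flag R → Bool)
    (ι : G →* (R ≃o R)) (Θ : Flag R) : Prop where
  coloring : IsColoring n (adj rk) C
  injective : Function.Injective ι
  color_eq_iff : ∀ X, C X = C Θ ↔ ∃ g, flagMap (ι g) Θ = X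

namespace IsHalfTransitive

variable {G : Type*} [Group G] {C : Flag R → Bool} {ι : G →* (R ≃o R)} {Θ : Flag R}
  (hR : IsPolytope n rk) (h : IsHalfTransitive n rk C ι Θ)

include hR h

theorem mem_range_iff {g : R ≃o R} : g ∈ ι.range ↔ C (flagMap g Θ) = C Θ := by
  rw [h.color_eq_iff]
  exact ⟨fun ⟨γ, e⟩ => ⟨γ, e ▸ rfl⟩, fun ⟨γ, e⟩ => ⟨γ, hR.eq_of_flagMap_eq e⟩⟩

/-- In the regular case the group is the rotation group with respect to any flag. -/
theorem rotGroup_eq_range (hn : 2 ≤ n) (hreg : IsRegular R) (Θ' : Flag R) :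
    rotGroup n rk Θ' = ι.range := by
  ext g
  rw [hR.mem_rotGroup_iff (.inl hreg) hn h.coloring, h.mem_range_iff hR]
  exact ⟨fun e => hR.color_flagMap h.coloring e _, fun e => hR.color_flagMap h.coloring e _⟩

theorem isDirectlyRegular (hn : 2 ≤ n) (hreg : IsRegular R) : IsDirectlyRegular n rk := by
  refine ⟨hreg, fun Θ' => ?_⟩
  rw [Subgroup.index_eq_two_iff]
  refine ⟨reflGen rk Θ' 0, fun b => ?_⟩
  have hC := h.coloring
  rw [hR.mem_rotGroup_iff (.inl hreg) hn hC, hR.mem_rotGroup_iff (.inl hreg) hn hC, flagMap_mul,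
    hR.flagMap_reflGen hreg Θ' le_rfl (by omega), hR.flagMap_adj, hC.flip 0 _ le_rfl (by omega)]
  cases C (flagMap b Θ') <;> cases C Θ' <;> simp [Xor]

/-- A single automorphism which exchanges the two colour classes makes the polytope regular. -/
theorem isRegular_of_sameOrbit (hn : 2 ≤ n) (h0 : SameOrbit Θ (adj rk 0 Θ)) : IsRegular R := by
  have key : ∀ X, SameOrbit Θ X := by
    intro X
    by_cases hX : C X = C Θ
    · obtain ⟨g, hg⟩ := (h.color_eq_iff X).1 hX
      exact sameOrbit_iff.2 ⟨_, hg⟩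
    · obtain ⟨g, hg⟩ := (h.color_eq_iff (adj rk 0 X)).1 (by
        rw [h.coloring.flip 0 _ le_rfl (by omega)]
        revert hX
        cases C X <;> cases C Θ <;> simp)
      have h1 := hR.sameOrbit_adj 0 (sameOrbit_iff.2 ⟨_, hg⟩)
      rw [hR.adj_adj] at h1
      exact h0.trans h1
  exact fun X Y => (key X).symm.trans (key Y)

theorem surjective_of_not_isRegular (hn : 2 ≤ n) (hreg : ¬ IsRegular R) (g : R ≃o R) :
    g ∈ ι.range := by
  rw [h.mem_range_iff hR]
  by_contra hg
  refine hreg (h.isRegular_of_sameOrbit hR hn ?_)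
  obtain ⟨γ, hγ⟩ := (h.color_eq_iff (adj rk 0 (flagMap g Θ))).1 (by
    rw [h.coloring.flip 0 _ le_rfl (by omega)]
    revert hg
    cases C (flagMap g Θ) <;> cases C Θ <;> simp)
  rw [← hR.flagMap_adj] at hγ
  refine sameOrbit_iff.2 ⟨g⁻¹ * ι γ, ?_⟩
  rw [flagMap_mul, hγ, flagMap_inv_eq rfl]

theorem isChiral (hn : 2 ≤ n) (hreg : ¬ IsRegular R) : IsChiral rk := by
  refine ⟨⟨Θ, adj rk 0 Θ, fun h0 => hreg (h.isRegular_of_sameOrbit hR hn h0), fun X => ?_⟩, ?_⟩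
  · by_cases hX : C X = C Θ
    · obtain ⟨g, hg⟩ := (h.color_eq_iff X).1 hX
      exact .inl (sameOrbit_iff.2 ⟨_, hg⟩)
    · obtain ⟨g, hg⟩ := (h.color_eq_iff (adj rk 0 X)).1 (by
        rw [h.coloring.flip 0 _ le_rfl (by omega)]
        revert hX
        cases C X <;> cases C Θ <;> simp)
      have h1 := hR.sameOrbit_adj 0 (sameOrbit_iff.2 ⟨_, hg⟩)
      rw [hR.adj_adj] at h1
      exact .inr h1
  · rintro X Y ⟨i, hi⟩ hXY
    obtain ⟨g, rfl⟩ := sameOrbit_iff.1 hXY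
    have hg := (h.mem_range_iff hR).1 (h.surjective_of_not_isRegular hR hn hreg g)
    have hX := hR.color_flagMap h.coloring hg X
    obtain ⟨h0, hin⟩ := hR.rank_of_isAdj hi
    rw [← hR.adj_eq hi, h.coloring.flip i X h0 hin] at hX
    simp at hX

theorem isChiral_or_isDirectlyRegular (hn : 2 ≤ n) :
    (IsChiral rk ∧ Nonempty ((R ≃o R) ≃* G)) ∨
      (IsDirectlyRegular n rk ∧ ∀ Θ' : Flag R, Nonempty (rotGroup n rk Θ' ≃* G)) := by
  by_cases hreg : IsRegular R
  · refine .inr ⟨h.isDirectlyRegular hR hn hreg, fun Θ' => ⟨?_⟩⟩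
    exact (MulEquiv.subgroupCongr (h.rotGroup_eq_range hR hn hreg Θ')).trans
      (MonoidHom.ofInjective h.injective).symm
  · refine .inl ⟨h.isChiral hR hn hreg, ⟨?_⟩⟩
    exact (MulEquiv.ofBijective ι
      ⟨h.injective, fun g => h.surjective_of_not_isRegular hR hn hreg g⟩).symm

end IsHalfTransitive

end

/-! ### The mix of the groups -/

/-- If corresponding generators have coprime orders, then the mix is the full direct product. -/
theorem mixGroup_eq_prod {m : ℕ} {G H : Type*} [Group G] [Group H] (α : Fin m → G) (α' : Fin m → H)
    (hco : ∀ k, (orderOf (α k)).Coprime (orderOf (α' k))) :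
    mixGroup α α' = (Subgroup.closure (range α)).prod (Subgroup.closure (range α')) := by
  refine le_antisymm ?_ ?_
  · refine (Subgroup.closure_le _).2 ?_
    rintro _ ⟨k, rfl⟩
    exact ⟨Subgroup.subset_closure (mem_range_self k), Subgroup.subset_closure (mem_range_self k)⟩
  · have hgen : ∀ k, (α k, α' k) ∈ mixGroup α α' := fun k => Subgroup.subset_closure ⟨k, rfl⟩
    have h1 : ∀ k, (α k, 1) ∈ mixGroup α α' := by
      intro k
      -- A power of `(α k, α' k)` whose exponent is `1` modulo one order and `0` modulo the other.
      obtain ⟨e, he, he'⟩ := Nat.chineseRemainder (hco k) 1 0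
      have h := pow_mem (hgen k) e
      rwa [Prod.pow_mk, (pow_eq_pow_iff_modEq).2 he, (pow_eq_pow_iff_modEq).2 he', pow_one,
        pow_zero] at h
    have h2 : ∀ k, (1, α' k) ∈ mixGroup α α' := by
      intro k
      obtain ⟨e, he, he'⟩ := Nat.chineseRemainder (hco k) 0 1
      have h := pow_mem (hgen k) e
      rwa [Prod.pow_mk, (pow_eq_pow_iff_modEq).2 he, (pow_eq_pow_iff_modEq).2 he', pow_one,
        pow_zero] at h
    have h3 : Subgroup.closure (range α) ≤ (mixGroup α α').comap (MonoidHom.inl G H) := by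
      refine (Subgroup.closure_le _).2 ?_
      rintro _ ⟨k, rfl⟩
      exact h1 k
    have h4 : Subgroup.closure (range α') ≤ (mixGroup α α').comap (MonoidHom.inr G H) := by
      refine (Subgroup.closure_le _).2 ?_
      rintro _ ⟨k, rfl⟩
      exact h2 k
    rintro ⟨g, g'⟩ ⟨hg, hg'⟩
    have := mul_mem (show (g, 1) ∈ mixGroup α α' from h3 hg)
      (show (1, g') ∈ mixGroup α α' from h4 hg')
    simpa using this

theorem closure_mixGens {m : ℕ} {G H : Type*} [Group G] [Group H] (α : Fin m → G)
    (α' : Fin m → H) : Subgroup.closure (range (mixGens α α')) = ⊤ := by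
  have h : range (mixGens α α') =
      ((↑) : mixGroup α α' → G × H) ⁻¹' range fun k => (α k, α' k) := by
    ext x
    constructor
    · rintro ⟨k, rfl⟩
      exact ⟨k, rfl⟩
    · rintro ⟨k, hk⟩
      exact ⟨k, Subtype.ext hk⟩
  rw [h]
  exact Subgroup.closure_closure_coe_preimage

/-! ### The mix of two polytopes -/

section Mix

variable {n : ℕ} {P Q : Type*} [LE P] [LE Q] {rkP : P → ℤ} {rkQ : Q → ℤ}
  {c : Flag P → Bool} {d : Flag Q → Bool} {Φ : Flag P} {Ψ : Flag Q}

/-- A polytope which is regular or chiral, with a two-colouring of its flags. -/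
structure IsOrientedPolytope (n : ℕ) {P : Type*} [LE P] (rk : P → ℤ) (c : Flag P → Bool) :
    Prop where
  polytope : IsPolytope n rk
  regular_or_chiral : IsRegular P ∨ IsChiral rk
  coloring : IsColoring n (adj rk) c

theorem IsOrientedPolytope.color_flagMap {rk : P → ℤ} (hP : IsOrientedPolytope n rk c)
    {g : P ≃o P} (hg : g ∈ rotGroup n rk Φ) (X : Flag P) : c (flagMap g X) = c X :=
  (hP.polytope.isRotaryAction_rotGens hP.regular_or_chiral Φ).color_act hP.polytope.isFlagSystem
    hP.coloring hg X

theorem mem_rotGroup_of_mem_mixGroup {g : (P ≃o P) × (Q ≃o Q)}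
    (hg : g ∈ mixGroup (rotGens n rkP Φ) (rotGens n rkQ Ψ)) :
    g.1 ∈ rotGroup n rkP Φ ∧ g.2 ∈ rotGroup n rkQ Ψ := by
  have : mixGroup (rotGens n rkP Φ) (rotGens n rkQ Ψ) ≤
      (rotGroup n rkP Φ).prod (rotGroup n rkQ Ψ) := by
    refine (Subgroup.closure_le _).2 ?_
    rintro _ ⟨k, rfl⟩
    exact ⟨Subgroup.subset_closure (mem_range_self k), Subgroup.subset_closure (mem_range_self k)⟩
  exact this hg

variable (hP : IsOrientedPolytope n rkP c) (hQ : IsOrientedPolytope n rkQ d)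

/-- The action of the mix of the rotation groups on pairs of flags of equal colour. -/
def mixAct (Φ : Flag P) (Ψ : Flag Q) (γ : mixGroup (rotGens n rkP Φ) (rotGens n rkQ Ψ))
    (z : Matched c d) : Matched c d :=
  ⟨(flagMap γ.1.1 z.1.1, flagMap γ.1.2 z.1.2), by
    rw [hP.color_flagMap (mem_rotGroup_of_mem_mixGroup γ.2).1,
      hQ.color_flagMap (mem_rotGroup_of_mem_mixGroup γ.2).2, z.2]⟩

theorem isRotaryAction_mixAct (hΦΨ : c Φ = d Ψ) :
    IsRotaryAction n (matchedOp hP.coloring hQ.coloring) (mixAct hP hQ Φ Ψ) ⟨(Φ, Ψ), hΦΨ⟩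
      (mixGens (rotGens n rkP Φ) (rotGens n rkQ Ψ)) where
  one_act z := Subtype.ext (Prod.ext (flagMap_one _) (flagMap_one _))
  mul_act _ _ z := Subtype.ext (Prod.ext (flagMap_mul _ _ _) (flagMap_mul _ _ _))
  act_comm _ i z :=
    Subtype.ext (Prod.ext (hP.polytope.flagMap_adj _ i _) (hQ.polytope.flagMap_adj _ i _))
  free γ h := by
    have h1 : (flagMap γ.1.1 Φ, flagMap γ.1.2 Ψ) = (Φ, Ψ) := congrArg Subtype.val h
    rw [Prod.ext_iff] at h1
    exact Subtype.ext (Prod.ext (hP.polytope.eq_one_of_flagMap_eq h1.1)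
      (hQ.polytope.eq_one_of_flagMap_eq h1.2))
  gen k := Subtype.ext (Prod.ext (hP.polytope.flagMap_rotGens hP.regular_or_chiral Φ k)
    (hQ.polytope.flagMap_rotGens hQ.regular_or_chiral Ψ k))

variable {p q : Fin (n - 1) → ℕ}

include hP hQ in
theorem coprimePeriods_of_hasType (hp : HasType n rkP p) (hq : HasType n rkQ q)
    (hpq : ∀ j, (p j).Coprime (q j)) : CoprimePeriods n (adj rkP) (adj rkQ) := by
  intro i h0 hi
  lift i to ℕ using h0
  have hk : i < n - 1 := by omega
  refine ⟨p ⟨i, hk⟩, q ⟨i, hk⟩, hpq _, fun X => ?_, fun Y => ?_⟩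
  · exact (hP.polytope.iterate_eq_iff hP.regular_or_chiral X ⟨i, hk⟩ _).2 (by rw [hp])
  · exact (hQ.polytope.iterate_eq_iff hQ.regular_or_chiral Y ⟨i, hk⟩ _).2 (by rw [hq])

theorem isFlagSystem_mix (hp : HasType n rkP p) (hq : HasType n rkQ q)
    (hpq : ∀ j, (p j).Coprime (q j)) :
    IsFlagSystem n (matchedOp hP.coloring hQ.coloring) :=
  isFlagSystem_matched hP.polytope.isFlagSystem hQ.polytope.isFlagSystem
    (coprimePeriods_of_hasType hP hQ hp hq hpq)

theorem isIncidence_mix (hn : 3 ≤ n) (hp : HasType n rkP p) (hq : HasType n rkQ q)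
    (hpq : ∀ j, (p j).Coprime (q j)) (hΦΨ : c Φ = d Ψ) :
    IsIncidence n (matchedOp hP.coloring hQ.coloring) (mixRank n rkP rkQ Φ Ψ)
      (cosetInc n (matchedOp hP.coloring hQ.coloring) (mixAct hP hQ Φ Ψ) ⟨(Φ, Ψ), hΦΨ⟩
        (mixGens (rotGens n rkP Φ) (rotGens n rkQ Ψ))) :=
  (isRotaryAction_mixAct hP hQ hΦΨ).isIncidence_cosetInc (isFlagSystem_mix hP hQ hp hq hpq)
    isColoring_matched hn (closure_mixGens _ _)

include hP hQ in
theorem isPolytope_mix (hn : 3 ≤ n) (hp : HasType n rkP p) (hq : HasType n rkQ q)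
    (hpq : ∀ j, (p j).Coprime (q j)) (hΦΨ : c Φ = d Ψ) :
    IsPolytope n (mixRank n rkP rkQ Φ Ψ) :=
  have : Nonempty (Matched c d) := ⟨⟨(Φ, Ψ), hΦΨ⟩⟩
  (isIncidence_mix hP hQ hn hp hq hpq hΦΨ).isPolytope (isFlagSystem_mix hP hQ hp hq hpq)

include hP hQ in
/-- The rotations of the mix, at any flag, have the orders `p k * q k`. -/
theorem hasType_mix (hn : 3 ≤ n) (hp : HasType n rkP p) (hq : HasType n rkQ q)
    (hpq : ∀ j, (p j).Coprime (q j)) (hΦΨ : c Φ = d Ψ)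
    (hreg : IsRegular (Mix n rkP rkQ Φ Ψ) ∨ IsChiral (mixRank n rkP rkQ Φ Ψ)) :
    HasType n (mixRank n rkP rkQ Φ Ψ) fun j => p j * q j := by
  intro Θ k
  have : Nonempty (Matched c d) := ⟨⟨(Φ, Ψ), hΦΨ⟩⟩
  have hr := isFlagSystem_mix hP hQ hp hq hpq
  have hi := isIncidence_mix hP hQ hn hp hq hpq hΦΨ
  obtain ⟨z, rfl⟩ := hi.flagOf_surjective hr Θ
  have hiter : ∀ m : ℕ, (fun X => adj (mixRank n rkP rkQ Φ Ψ) ((k : ℤ) + 1)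
      (adj (mixRank n rkP rkQ Φ Ψ) k X))^[m] (hi.flagOf hr z) =
      hi.flagOf hr ((fun z => matchedOp hP.coloring hQ.coloring ((k : ℤ) + 1)
        (matchedOp hP.coloring hQ.coloring k z))^[m] z) := by
    intro m
    induction m with
    | zero => rfl
    | succ m ih =>
      rw [Function.iterate_succ_apply', Function.iterate_succ_apply', ih, hi.adj_flagOf hr,
        hi.adj_flagOf hr]
  have hdvd : ∀ m : ℕ,
      orderOf (rotGens n (mixRank n rkP rkQ Φ Ψ) (hi.flagOf hr z) k) ∣ m ↔ p k ∣ m ∧ q k ∣ m := by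
    intro m
    rw [← (hi.isPolytope hr).iterate_eq_iff hreg, hiter, ← hp z.1.1 k, ← hq z.1.2 k,
      ← hP.polytope.iterate_eq_iff hP.regular_or_chiral,
      ← hQ.polytope.iterate_eq_iff hQ.regular_or_chiral]
    have hval := coe_iterate_matchedOp hP.coloring hQ.coloring (k : ℤ) z m
    rw [Prod.ext_iff] at hval
    constructor
    · intro e
      have e := hi.flagOf_injective hr e
      rw [e] at hval
      exact ⟨hval.1.symm, hval.2.symm⟩
    · rintro ⟨e1, e2⟩
      exact congrArg _ (Subtype.ext (Prod.ext (hval.1.trans e1) (hval.2.trans e2)))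
  refine Nat.dvd_antisymm ((hdvd _).2 ⟨dvd_mul_right _ _, dvd_mul_left _ _⟩) ?_
  have h := (hdvd _).1 dvd_rfl
  exact (hpq k).mul_dvd_of_dvd_of_dvd h.1 h.2

include hP hQ in
/-- Left multiplication makes the mix of the rotation groups transitive on each colour class of
flags of the mix. -/
theorem isHalfTransitive_mix (hn : 3 ≤ n) (hp : HasType n rkP p) (hq : HasType n rkQ q)
    (hpq : ∀ j, (p j).Coprime (q j)) (hΦΨ : c Φ = d Ψ) :
    ∃ C Θ, IsHalfTransitive n (mixRank n rkP rkQ Φ Ψ) C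
      (leftMul n (mixGens (rotGens n rkP Φ) (rotGens n rkQ Ψ))) Θ ∧
      ∀ k : Fin (n - 1), flagMap (leftMul n (mixGens (rotGens n rkP Φ) (rotGens n rkQ Ψ))
        (mixGens (rotGens n rkP Φ) (rotGens n rkQ Ψ) k)) Θ =
        adj (mixRank n rkP rkQ Φ Ψ) ((k : ℤ) + 1) (adj (mixRank n rkP rkQ Φ Ψ) k Θ) := by
  have : Nonempty (Matched c d) := ⟨⟨(Φ, Ψ), hΦΨ⟩⟩
  have hr := isFlagSystem_mix hP hQ hp hq hpq
  have hi := isIncidence_mix hP hQ hn hp hq hpq hΦΨ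
  have ha := isRotaryAction_mixAct hP hQ hΦΨ
  have hcol : IsColoring n (matchedOp hP.coloring hQ.coloring) fun z => c z.1.1 :=
    isColoring_matched
  have hmul := flagMap_leftMul hr ha hi
  choose ζ hζ using hi.flagOf_surjective hr
  have hζ' : ∀ z, ζ (hi.flagOf hr z) = z := fun z => hi.flagOf_injective hr (hζ _)
  refine ⟨fun X => c (ζ X).1.1, hi.flagOf hr ⟨(Φ, Ψ), hΦΨ⟩, ⟨⟨?_, ?_⟩, ?_, ?_⟩, ?_⟩
  · intro i X h0 hin
    rw [← hζ X, hi.adj_flagOf hr, hζ', hζ']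
    exact hcol.flip i (ζ X) h0 hin
  · intro i X h
    rw [← hζ X, hi.adj_flagOf hr, hζ', hζ']
    exact hcol.fix i (ζ X) h
  · intro γ γ' e
    have h := hmul γ ⟨(Φ, Ψ), hΦΨ⟩
    rw [e, hmul] at h
    exact (ha.eq_of_act_eq (hi.flagOf_injective hr h)).symm
  · intro X
    obtain ⟨z, rfl⟩ := hi.flagOf_surjective hr X
    simp only [hζ', hmul]
    constructor
    · intro h
      have hconn : Conn (matchedOp hP.coloring hQ.coloring) {-1}ᶜ ⟨(Φ, Ψ), hΦΨ⟩ z := by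
        refine hr.conn_mono (fun k _ h0 _ hk => ?_) (hr.conn _ z)
        rw [mem_singleton_iff] at hk
        omega
      obtain ⟨g, _, e⟩ := ha.exists_mem_faceSubgroup hr hcol (by omega) hconn h
      exact ⟨g, by rw [e]⟩
    · rintro ⟨γ, e⟩
      have e := hi.flagOf_injective hr e
      rw [← e]
      exact hP.color_flagMap (mem_rotGroup_of_mem_mixGroup γ.2).1 Φ
  · intro k
    rw [hmul, hi.adj_flagOf hr, hi.adj_flagOf hr, ha.gen]

end Mix

/-! ### The chirality criterion -/

/-- Let the group `A` be generated by a subgroup `ι G` of index two, in which `ρ` conjugates, and the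
involution `ρ` outside. If every normal subgroup of `A` containing `ι (ker π)` contains `ι G`, then
`π` and its conjugate under `ρ` together map `G` onto `H × H`. -/
theorem exists_surjective_prod {A G H : Type*} [Group A] [Group G] [Group H] (ι : G →* A)
    (hι : Function.Injective ι) (hidx : ι.range.index = 2) (ρ : A) (hρ : ρ * ρ = 1)
    (hρι : ρ ∉ ι.range) (π : G →* H) (hπ : Function.Surjective π)
    (hN : ∀ N : Subgroup A, N.Normal → π.ker.map ι ≤ N → ι.range ≤ N) :
    ∃ f : G →* H × H, Function.Surjective f := by
  have hnormal : ι.range.Normal := Subgroup.normal_of_index_eq_two hidx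
  -- `θ` is conjugation by `ρ`, read in `G`.
  obtain ⟨θ, hθ⟩ : ∃ θ : G →* G, ∀ g, ι (θ g) = ρ * ι g * ρ⁻¹ := by
    refine ⟨(((MonoidHom.ofInjective hι).trans (MulAut.conjNormal ρ)).trans
      (MonoidHom.ofInjective hι).symm).toMonoidHom, fun g => ?_⟩
    have h := congrArg Subtype.val ((MonoidHom.ofInjective hι).apply_symm_apply
      (MulAut.conjNormal ρ (MonoidHom.ofInjective hι g)))
    rw [MonoidHom.ofInjective_apply] at h
    exact h
  have hρinv : ρ⁻¹ = ρ := inv_eq_of_mul_eq_one_left hρ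
  have hθθ : ∀ g, θ (θ g) = g := by
    intro g
    apply hι
    rw [hθ, hθ, hρinv, ← mul_assoc, ← mul_assoc, hρ, one_mul, mul_assoc, hρ, mul_one]
  -- The product `D` of `ker π` and its conjugate is mapped to a normal subgroup of `A`.
  set D : Subgroup G := π.ker ⊔ (π.comp θ).ker with hD
  have hDθ : ∀ g ∈ D, θ g ∈ D := by
    intro g hg
    rw [hD, Subgroup.mem_sup_of_normal_right] at hg
    obtain ⟨a, ha, b, hb, rfl⟩ := hg
    rw [map_mul]
    refine mul_mem (Subgroup.mem_sup_right ?_) (Subgroup.mem_sup_left ?_)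
    · rw [MonoidHom.mem_ker, MonoidHom.comp_apply, hθθ]
      exact ha
    · exact hb
  have hcover : ∀ a : A, ∃ g, a = ι g ∨ a = ι g * ρ := by
    intro a
    by_cases ha : a ∈ ι.range
    · obtain ⟨g, rfl⟩ := ha
      exact ⟨g, .inl rfl⟩
    · have h : a * ρ ∈ ι.range := by
        rw [Subgroup.mul_mem_iff_of_index_two hidx]
        tauto
      obtain ⟨g, hg⟩ := h
      exact ⟨g, .inr (by rw [hg, mul_assoc, hρ, mul_one])⟩
  have hDnormal : (D.map ι).Normal := by
    have hconj : ∀ g, ∀ x ∈ D.map ι, ι g * x * (ι g)⁻¹ ∈ D.map ι := by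
      rintro g _ ⟨x, hx, rfl⟩
      rw [← map_mul, ← map_inv, ← map_mul]
      have hDn : D.Normal := inferInstanceAs (π.ker ⊔ (π.comp θ).ker).Normal
      exact Subgroup.mem_map_of_mem ι (hDn.conj_mem x hx g)
    refine ⟨fun x hx a => ?_⟩
    obtain ⟨g, rfl | rfl⟩ := hcover a
    · exact hconj g x hx
    · have hx' : ρ * x * ρ⁻¹ ∈ D.map ι := by
        obtain ⟨y, hy, rfl⟩ := hx
        rw [← hθ]
        exact Subgroup.mem_map_of_mem ι (hDθ y hy)
      have h := hconj g _ hx'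
      rw [mul_inv_rev]
      simpa only [mul_assoc] using h
  have htop : ∀ g : G, g ∈ D := by
    intro g
    have h := hN _ hDnormal (Subgroup.map_mono le_sup_left) ⟨g, rfl⟩
    obtain ⟨g', hg', e⟩ := h
    rwa [← hι e]
  refine ⟨π.prod (π.comp θ), ?_⟩
  rintro ⟨a, b⟩
  obtain ⟨x, rfl⟩ := hπ a
  obtain ⟨y', rfl⟩ := hπ b
  obtain ⟨y, rfl⟩ : ∃ y, θ y = y' := ⟨θ y', hθθ y'⟩
  have h := htop (x⁻¹ * y)
  rw [hD, Subgroup.mem_sup_of_normal_right] at h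
  obtain ⟨u, hu, v, hv, huv⟩ := h
  have hxy : x * u = y * v⁻¹ := by
    rw [eq_mul_inv_iff_mul_eq, mul_assoc, huv, mul_inv_cancel_left]
  refine ⟨x * u, Prod.ext ?_ ?_⟩
  · change π (x * u) = π x
    rw [map_mul, MonoidHom.mem_ker.1 hu, mul_one]
  · change (π.comp θ) (x * u) = (π.comp θ) y
    rw [hxy, map_mul, map_inv, MonoidHom.mem_ker.1 hv, inv_one, mul_one]

theorem hasSubgroupWithQuotient_of_surjective {A B : Type*} [Group A] [Group B] (f : A →* B)
    (hf : Function.Surjective f) : HasSubgroupWithQuotient A B := by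
  refine ⟨⊤, (f.comp (⊤ : Subgroup A).subtype).ker, inferInstance,
    ⟨QuotientGroup.quotientKerEquivOfSurjective _ fun b => ?_⟩⟩
  obtain ⟨a, ha⟩ := hf b
  exact ⟨⟨a, Subgroup.mem_top a⟩, ha⟩

/-- The order of a group is a multiple of the order of each quotient of a subgroup. -/
theorem HasSubgroupWithQuotient.card_dvd {A B : Type*} [Group A] [Group B]
    (h : HasSubgroupWithQuotient A B) : Nat.card B ∣ Nat.card A := by
  obtain ⟨H, N, _, ⟨e⟩⟩ := h
  rw [← Nat.card_congr e.toEquiv]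
  exact (Subgroup.card_quotient_dvd_card N).trans (Subgroup.card_subgroup_dvd_card H)

section Regular

variable {n : ℕ} {R : Type*} [LE R] {rk : R → ℤ}

/-- The reflections of a regular polytope satisfy the relations of the universal string Coxeter
group. -/
theorem IsPolytope.isLiftable_reflGen (hR : IsPolytope n rk) (hreg : IsRegular R) (Θ : Flag R) :
    (stringMatrix n).IsLiftable fun i : Fin n => reflGen rk Θ i := by
  have hρ : ∀ i : Fin n, flagMap (reflGen rk Θ i) Θ = adj rk i Θ := fun i =>
    hR.flagMap_reflGen hreg Θ (by omega) (by have := i.2; omega)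
  intro i j
  refine hR.eq_one_of_flagMap_eq (X := Θ) ?_
  by_cases hij : i = j
  · subst hij
    have hM : (stringMatrix n).M i i = 1 := (stringMatrix n).diagonal i
    rw [hM, pow_one, flagMap_mul, hρ, hR.flagMap_adj, hρ, hR.adj_adj]
  by_cases hadj : (i : ℕ) + 1 = j ∨ (j : ℕ) + 1 = i
  · have hM : (stringMatrix n).M i j = 0 := by simp [stringMatrix, hij, hadj]
    rw [hM, pow_zero, flagMap_one]
  · have hM : (stringMatrix n).M i j = 2 := by simp [stringMatrix, hij, hadj]
    have hcomm : adj rk i (adj rk j Θ) = adj rk j (adj rk i Θ) := by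
      have hne : (i : ℕ) ≠ j := fun h => hij (Fin.ext h)
      rcases lt_or_gt_of_ne hne with h | h
      · exact hR.adj_comm (by omega) Θ
      · exact (hR.adj_comm (by omega) Θ).symm
    rw [hM, pow_two]
    simp only [flagMap_mul, hρ, hR.flagMap_adj]
    rw [← hcomm, hR.adj_adj, hR.adj_adj]

end Regular

/-- If a regular polytope has a half-transitive group `G`, generated by the rotations `t k`, which
is mapped onto the group of a totally chiral polytope `P` by `t k ↦ σₖ₊₁`, then `G` has the quotient
`Γ(P) × Γ(P)`. -/
theorem exists_surjective_of_isTotallyChiral {n : ℕ} {R P G : Type*} [LE R] [LE P] [Group G]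
    {rk : R → ℤ} {rkP : P → ℤ} {C : Flag R → Bool} {ι : G →* (R ≃o R)} {Θ : Flag R} {Φ : Flag P}
    (hR : IsPolytope n rk) (hn : 2 ≤ n) (hreg : IsRegular R) (h : IsHalfTransitive n rk C ι Θ)
    (t : Fin (n - 1) → G) (hgen : Subgroup.closure (range t) = ⊤)
    (ht : ∀ k, flagMap (ι (t k)) Θ = adj rk ((k : ℤ) + 1) (adj rk k Θ)) (π : G →* (P ≃o P))
    (hπ : Function.Surjective π) (hπt : ∀ k, π (t k) = rotGens n rkP Φ k)
    (htc : IsTotallyChiral n rkP Φ) :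
    ∃ f : G →* (P ≃o P) × (P ≃o P), Function.Surjective f := by
  have hidx : ι.range.index = 2 := by
    rw [← h.rotGroup_eq_range hR hn hreg Θ]
    exact (h.isDirectlyRegular hR hn hreg).2 Θ
  have hρ := hR.flagMap_reflGen hreg Θ le_rfl (show (0 : ℤ) < n by omega)
  refine exists_surjective_prod ι h.injective hidx (reflGen rk Θ 0) ?_ ?_ π hπ fun N hN hker => ?_
  · refine hR.eq_one_of_flagMap_eq (X := Θ) ?_
    rw [flagMap_mul, hρ, hR.flagMap_adj, hρ, hR.adj_adj]
  · rw [h.mem_range_iff hR, hρ, h.coloring.flip 0 Θ le_rfl (by omega)]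
    simp
  · set η : UnivGroup n →* (R ≃o R) := (stringMatrix n).toCoxeterSystem.lift
      ⟨_, hR.isLiftable_reflGen hreg Θ⟩ with hη
    have hηs : ∀ k, η (univRot n k) = ι (t k) := by
      intro k
      have hk := k.2
      have h1 : ∀ i, η ((stringMatrix n).simple i) = reflGen rk Θ i := fun i =>
        (stringMatrix n).toCoxeterSystem.lift_apply_simple (hR.isLiftable_reflGen hreg Θ) i
      rw [univRot, map_mul, h1, h1]
      refine hR.eq_of_flagMap_eq (X := Θ) ?_
      rw [ht, flagMap_mul]
      simp only [Nat.cast_add, Nat.cast_one]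
      rw [hR.flagMap_reflGen hreg Θ (by omega) (by omega), hR.flagMap_adj,
        hR.flagMap_reflGen hreg Θ (by omega) (by omega)]
    have hηlift : ∀ w, η (FreeGroup.lift (univRot n) w) = ι (FreeGroup.lift t w) := by
      intro w
      have : η.comp (FreeGroup.lift (univRot n)) = ι.comp (FreeGroup.lift t) := by
        ext k
        simp [hηs]
      exact DFunLike.congr_fun this w
    have hπlift : ∀ w, π (FreeGroup.lift t w) = FreeGroup.lift (rotGens n rkP Φ) w := by
      intro w
      have : π.comp (FreeGroup.lift t) = FreeGroup.lift (rotGens n rkP Φ) := by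
        ext k
        simp [hπt]
      exact DFunLike.congr_fun this w
    -- The preimage of `N` in the universal group contains the kernel of `W⁺ → Γ(P)`, thus `W⁺`.
    have hW : univRotGroup n ≤ N.comap η := by
      rw [← htc]
      refine Subgroup.normalClosure_le_normal ?_
      rintro _ ⟨w, hw, rfl⟩
      have hw' : FreeGroup.lift (rotGens n rkP Φ) w = 1 := hw
      change η _ ∈ N
      rw [hηlift]
      refine hker (Subgroup.mem_map_of_mem ι ?_)
      rw [MonoidHom.mem_ker, hπlift, hw']
    rw [MonoidHom.range_eq_map, ← hgen, Subgroup.map_le_iff_le_comap, Subgroup.closure_le]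
    rintro _ ⟨k, rfl⟩
    change ι (t k) ∈ N
    rw [← hηs]
    exact hW (Subgroup.subset_closure (mem_range_self k))

end AbsPoly

theorem mainTheorem1 (n : ℕ) {P Q : Type*} [PartialOrder P] [PartialOrder Q]
    [Finite P] [Finite Q] (rkP : P → ℤ) (rkQ : Q → ℤ)
    (hP : AbsPoly.IsPolytope n rkP) (hPc : AbsPoly.IsChiral rkP)
    (hQ : AbsPoly.IsPolytope n rkQ) (hQr : AbsPoly.IsDirectlyRegular n rkQ)
    (p q : Fin (n - 1) → ℕ)
    (hp : AbsPoly.HasType n rkP p) (hq : AbsPoly.HasType n rkQ q)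
    (hpq : ∀ j, Nat.Coprime (p j) (q j))
    (Φ : Flag P) (Ψ : Flag Q) :
    -- the mix of the groups is the full direct product `Γ(P) × Γ⁺(Q)`
    AbsPoly.mixGroup (AbsPoly.rotGens n rkP Φ) (AbsPoly.rotGens n rkQ Ψ) =
        Subgroup.prod ⊤ (AbsPoly.rotGroup n rkQ Ψ) ∧
      -- the mix is an `n`-polytope of the product type
      AbsPoly.IsPolytope n (AbsPoly.mixRank n rkP rkQ Φ Ψ) ∧
      AbsPoly.HasType n (AbsPoly.mixRank n rkP rkQ Φ Ψ) (fun j => p j * q j) ∧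
      -- it is chiral or directly regular, with (rotation) group `Γ(P) × Γ⁺(Q)`
      ((AbsPoly.IsChiral (AbsPoly.mixRank n rkP rkQ Φ Ψ) ∧
          Nonempty ((AbsPoly.Mix n rkP rkQ Φ Ψ ≃o AbsPoly.Mix n rkP rkQ Φ Ψ) ≃*
            (P ≃o P) × AbsPoly.rotGroup n rkQ Ψ)) ∨
        (AbsPoly.IsDirectlyRegular n (AbsPoly.mixRank n rkP rkQ Φ Ψ) ∧
          ∀ Θ : Flag (AbsPoly.Mix n rkP rkQ Φ Ψ),
            Nonempty (AbsPoly.rotGroup n (AbsPoly.mixRank n rkP rkQ Φ Ψ) Θ ≃*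
              (P ≃o P) × AbsPoly.rotGroup n rkQ Ψ))) ∧
      -- the criterion for chirality of the mix
      (AbsPoly.IsTotallyChiral n rkP Φ →
        ¬ AbsPoly.HasSubgroupWithQuotient ((P ≃o P) × AbsPoly.rotGroup n rkQ Ψ)
            ((P ≃o P) × (P ≃o P)) →
        AbsPoly.IsChiral (AbsPoly.mixRank n rkP rkQ Φ Ψ)) ∧
      -- the special case of the criterion in terms of group orders
      (¬ Nat.card (P ≃o P) ∣ Nat.card (AbsPoly.rotGroup n rkQ Ψ) →
        ¬ AbsPoly.HasSubgroupWithQuotient ((P ≃o P) × AbsPoly.rotGroup n rkQ Ψ)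
            ((P ≃o P) × (P ≃o P))) := by
  have hn : 3 ≤ n := hP.three_le_of_isChiral hPc
  have hPo : AbsPoly.IsOrientedPolytope n rkP (AbsPoly.orbitColor Φ) :=
    ⟨hP, .inr hPc, hP.isColoring_orbitColor hPc Φ⟩
  have hQo : AbsPoly.IsOrientedPolytope n rkQ (AbsPoly.rotColor n rkQ Ψ) :=
    ⟨hQ, .inl hQr.1, hQ.isColoring_rotColor hQr Ψ⟩
  have hΦΨ : AbsPoly.orbitColor Φ Φ = AbsPoly.rotColor n rkQ Ψ Ψ := by
    rw [AbsPoly.orbitColor_eq_true.2 (AbsPoly.sameOrbit_refl Φ)]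
    have h := (hQ.rotColor_flagMap (Φ := Ψ) (g := 1)).2 (one_mem _)
    rw [AbsPoly.flagMap_one] at h
    exact h.symm
  have hprod : AbsPoly.mixGroup (AbsPoly.rotGens n rkP Φ) (AbsPoly.rotGens n rkQ Ψ) =
      Subgroup.prod ⊤ (AbsPoly.rotGroup n rkQ Ψ) := by
    rw [AbsPoly.mixGroup_eq_prod _ _ fun k => by rw [hp, hq]; exact hpq k,
      ← hP.rotGroup_eq_top hPc (by omega) Φ]
    rfl
  have e : AbsPoly.mixGroup (AbsPoly.rotGens n rkP Φ) (AbsPoly.rotGens n rkQ Ψ) ≃*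
      (P ≃o P) × AbsPoly.rotGroup n rkQ Ψ :=
    (MulEquiv.subgroupCongr hprod).trans
      ((Subgroup.prodEquiv ⊤ _).trans (Subgroup.topEquiv.prodCongr (MulEquiv.refl _)))
  have hM := AbsPoly.isPolytope_mix hPo hQo hn hp hq hpq hΦΨ
  obtain ⟨C, Θ, hhalf, hΘ⟩ := AbsPoly.isHalfTransitive_mix hPo hQo hn hp hq hpq hΦΨ
  have hcases := hhalf.isChiral_or_isDirectlyRegular hM (by omega)
  refine ⟨hprod, hM, ?_, ?_, fun htc hno => ?_, fun hcard hsub => ?_⟩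
  · exact AbsPoly.hasType_mix hPo hQo hn hp hq hpq hΦΨ
      (hcases.elim (fun h => .inr h.1) fun h => .inl h.1.1)
  · exact hcases.imp (fun h => ⟨h.1, h.2.map fun f => f.trans e⟩)
      fun h => ⟨h.1, fun Θ' => (h.2 Θ').map fun f => f.trans e⟩
  · refine hhalf.isChiral hM (by omega) fun hreg => hno ?_
    have hπ : Function.Surjective ((MonoidHom.fst (P ≃o P) (Q ≃o Q)).comp
        (AbsPoly.mixGroup (AbsPoly.rotGens n rkP Φ) (AbsPoly.rotGens n rkQ Ψ)).subtype) :=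
      fun g => ⟨⟨(g, 1), by rw [hprod]; exact ⟨Subgroup.mem_top g, one_mem _⟩⟩, rfl⟩
    obtain ⟨f, hf⟩ := AbsPoly.exists_surjective_of_isTotallyChiral hM (by omega) hreg hhalf _
      (AbsPoly.closure_mixGens _ _) hΘ _ hπ (fun _ => rfl) htc
    exact AbsPoly.hasSubgroupWithQuotient_of_surjective (f.comp e.symm.toMonoidHom)
      (hf.comp e.symm.surjective)
  · have hfin : Finite (P ≃o P) := DFunLike.finite _
    refine hcard (Nat.dvd_of_mul_dvd_mul_left (Nat.card_pos (α := P ≃o P)) ?_)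
    rw [← Nat.card_prod, ← Nat.card_prod]
    exact hsub.card_dvd
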